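/- **Setting.** Let $m\ge 1$ be an integer, $\lambda\in\mathbb R$, $c>0$, $C\in\mathbb R$. For an integer $N$ with $2m\le N+1$ let $\alpha_1^N,\dots,\alpha_m^N>0$ satisfy $\alpha_1^N\ge c$ and $\sum_{k=1}^m k^2\alpha_k^N\le C$, and put $$\tilde\alpha_k^N=\alpha_k^N+\frac{\lambda^2}{N}\,\frac{k-2}{2}\,\alpha_k^N-\frac{\lambda^2}{Nk}\sum_{\ell=k+1}^{m}(2\ell-k)\alpha_\ell^N ,\qquad 1\le k\le m .$$ Assume $\tilde\alpha^N_k\ge 0$ for all $k$. Write $\nabla_k\varphi_x=\varphi_{x+k}-\varphi_x$ and $\Delta_k\varphi_x=\varphi_{x+k}+\varphi_{x-k}-2\varphi_x$. For $x\in\{0,\dots,N\}$ set $$\mathscr L^N\varphi_x=\frac{N^2}{2}\sum_{k=1}^m\tilde\alpha_k^N\Big[\mathbf 1_{m\le x\le N-m}\,\Delta_k\varphi_x+\mathbf 1_{0\le x\le m-1}\big(\nabla_k\varphi_x+\nabla_{-(k\wedge x)}\varphi_x\big)+\mathbf 1_{N-m+1\le x\le N}\big(\nabla_{-k}\varphi_x+\nabla_{k\wedge(N-x)}\varphi_x\big)\Big]$$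 $$\qquad\qquad+N^2\,\mathbf 1_{x=0}\,(\varphi_{-1}-\varphi_0)+N^2\,\mathbf 1_{x=N}\,(\varphi_{N+1}-\varphi_N).$$ For $\mathscr A_-,\mathscr A_+\in\mathbb R$ let $\mathscr U^N_{S,T,x,y}$ ($0\le S\le T$, $x,y\in\{0,\dots,N\}$) be the heat kernel with Robin boundary conditions, i.e. the solution of $$\partial_T\mathscr U^N_{S,T,x,y}=\mathscr L^N\mathscr U^N_{S,T,x,y},\quad \mathscr U^N_{S,S,x,y}=\mathbf 1_{x=y},\quad \mathscr U^N_{S,T,-1,y}=\Big(1-\frac{\mathscr A_-}{N}\Big)\mathscr U^N_{S,T,0,y},\quad \mathscr U^N_{S,T,N+1,y}=\Big(1-\frac{\mathscr A_+}{N}\Big)\mathscr U^N_{S,T,N,y},$$ where $\mathscr L^N$ acts on $x$. Let $\mathscr U^{N,0}$ be the Neumann kernel, i.e. the case $\mathscr A_\pm=0$. For $\kappa>0$ put $$\mathscr E^{N,\kappa}_{S,T,x,y}=\exp\Big[\kappa\,\frac{|x-y|}{N|T-S|^{1/2}\vee 1}\Big],\qquad b^N_{S,T}=\big[N^{-1}+N^{-1}|T-S|^{-1/2}\big]\wedge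 1,\qquad b^N_{S,S}=1 .$$ **Proposition.** Let $\kappa>0$ and $T_f\in\mathbb R$. 1. There is a constant $K>0$ depending only on $m,\lambda,c,C,T_f,\kappa$ such that for all $N$ and $\alpha^N$ as above, all $0\le S\le T\le T_f$ and all $x,y\in\{0,\dots,N\}$, $$0\le \mathscr U^{N,0}_{S,T,x,y}\,\mathscr E^{N,\kappa}_{S,T,x,y}\le K\,b^N_{S,T}.$$ 2. For all $\mathscr A_-,\mathscr A_+\in\mathbb R$ there is a constant $K>0$ depending only on $m,\lambda,c,C,T_f,\kappa,\mathscr A_-,\mathscr A_+$ such that for all $N$ and $\alpha^N$ as above and all $0\le S\le T\le T_f$, $$\sup_{x,y}\big|\mathscr U^{N}_{S,T,x,y}\,\mathscr E^{N,\kappa}_{S,T,x,y}\big|\le K\,b^N_{S,T},\qquad \sup_{x}\sum_{y}\big|\mathscr U^{N}_{S,T,x,y}\,\mathscr E^{N,\kappa}_{S,T,x,y}\big|\le K .$$ -/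

import Mathlib

noncomputable section

/-- The modified jump coefficients
`α̃_k = α_k + N⁻¹ λ² (k - 2)/2 α_k - N⁻¹ (λ²/k) ∑_{ℓ = k+1}^{m} (2ℓ - k) α_ℓ`. -/
def modCoeff (N m : ℕ) (lam : ℝ) (α : ℕ → ℝ) (k : ℕ) : ℝ :=
  α k + (N : ℝ)⁻¹ * lam ^ 2 * (((k : ℝ) - 2) / 2) * α k
    - (N : ℝ)⁻¹ * (lam ^ 2 / (k : ℝ)) *
      ∑ l ∈ Finset.Icc (k + 1) m, (2 * (l : ℝ) - (k : ℝ)) * α l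

/-- `∇_k φ_x = φ_{x+k} - φ_x`. -/
def latGrad (k : ℤ) (φ : ℤ → ℝ) (x : ℤ) : ℝ := φ (x + k) - φ x

/-- `Δ_k φ_x = φ_{x+k} + φ_{x-k} - 2 φ_x`. -/
def latLap (k : ℤ) (φ : ℤ → ℝ) (x : ℤ) : ℝ := φ (x + k) + φ (x - k) - 2 * φ x

/-- The long-range lattice Laplacian on `⟦0, N⟧`, with range `m`, coefficients `a_1, …, a_m` and
diffusive scaling `N²`. In the left zone `⟦0, m-1⟧` a leftward jump `k` is cut to `k ∧ x`; in the
right zone `⟦N-m+1, N⟧` a rightward jump `k` is cut to `k ∧ (N - x)`. -/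
def lapBulk (N m : ℕ) (a : ℕ → ℝ) (φ : ℤ → ℝ) (x : ℤ) : ℝ :=
  (if (m : ℤ) ≤ x ∧ x ≤ (N : ℤ) - m then
    (1 / 2) * ∑ k ∈ Finset.Icc 1 m, a k * ((N : ℝ) ^ 2 * latLap (k : ℤ) φ x) else 0)
  + (if 0 ≤ x ∧ x ≤ (m : ℤ) - 1 then
    (1 / 2) * ∑ k ∈ Finset.Icc 1 m, a k * ((N : ℝ) ^ 2 * latGrad (k : ℤ) φ x)
    + (1 / 2) * ∑ k ∈ Finset.Icc 1 m, a k * ((N : ℝ) ^ 2 * latGrad (-(min (k : ℤ) x)) φ x) else 0)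
  + (if (N : ℤ) - m + 1 ≤ x ∧ x ≤ (N : ℤ) then
    (1 / 2) * ∑ k ∈ Finset.Icc 1 m, a k * ((N : ℝ) ^ 2 * latGrad (-(k : ℤ)) φ x)
    + (1 / 2) * ∑ k ∈ Finset.Icc 1 m,
        a k * ((N : ℝ) ^ 2 * latGrad (min (k : ℤ) ((N : ℤ) - x)) φ x) else 0)

/-- The lattice Laplacian acting on functions that are also defined at the two ghost sites `-1` and
`N + 1`: the end points `0` and `N` in addition exchange with their ghost neighbours. Under
`φ_{-1} = (1 - A₋/N) φ_0` and `φ_{N+1} = (1 - A₊/N) φ_N` the exchange terms are `-N A₋ φ_0` and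
`-N A₊ φ_N`, so they vanish in the Neumann case `A₋ = A₊ = 0`. -/
def lapGhost (N m : ℕ) (a : ℕ → ℝ) (φ : ℤ → ℝ) (x : ℤ) : ℝ :=
  lapBulk N m a φ x
  + (if x = 0 then (N : ℝ) ^ 2 * latGrad (-1) φ x else 0)
  + (if x = (N : ℤ) then (N : ℝ) ^ 2 * latGrad 1 φ x else 0)

/-- Extension of a function on `⟦0, N⟧` to the ghost sites by the Robin boundary conditions
`φ_{-1} = (1 - A₋/N) φ_0`, `φ_{N+1} = (1 - A₊/N) φ_N`. (The value `0` at all other sites is never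
used when `2m ≤ N + 1`.) -/
def robinExt (N : ℕ) (Am Ap : ℝ) (φ : Fin (N + 1) → ℝ) (x : ℤ) : ℝ :=
  if x = -1 then (1 - Am / (N : ℝ)) * φ 0
  else if x = (N : ℤ) + 1 then (1 - Ap / (N : ℝ)) * φ (Fin.last N)
  else if h : 0 ≤ x ∧ x ≤ (N : ℤ) then φ ⟨x.toNat, by omega⟩
  else 0

theorem robinExt_add (N : ℕ) (Am Ap : ℝ) (φ ψ : Fin (N + 1) → ℝ) (x : ℤ) :
    robinExt N Am Ap (φ + ψ) x = robinExt N Am Ap φ x + robinExt N Am Ap ψ x := by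
  unfold robinExt
  split_ifs <;> simp [mul_add]

theorem robinExt_smul (N : ℕ) (Am Ap r : ℝ) (φ : Fin (N + 1) → ℝ) (x : ℤ) :
    robinExt N Am Ap (r • φ) x = r * robinExt N Am Ap φ x := by
  unfold robinExt
  split_ifs <;> simp [mul_left_comm]

theorem lapGhost_add (N m : ℕ) (a : ℕ → ℝ) (φ ψ χ : ℤ → ℝ) (h : ∀ z, χ z = φ z + ψ z) (x : ℤ) :
    lapGhost N m a χ x = lapGhost N m a φ x + lapGhost N m a ψ x := by
  have hL : ∀ k y, latLap k χ y = latLap k φ y + latLap k ψ y := by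
    intro k y; simp only [latLap, h]; ring
  have hG : ∀ k y, latGrad k χ y = latGrad k φ y + latGrad k ψ y := by
    intro k y; simp only [latGrad, h]; ring
  simp only [lapGhost, lapBulk, hL, hG, mul_add, Finset.sum_add_distrib]
  split_ifs <;> ring

theorem lapGhost_smul (N m : ℕ) (a : ℕ → ℝ) (r : ℝ) (φ χ : ℤ → ℝ) (h : ∀ z, χ z = r * φ z)
    (x : ℤ) : lapGhost N m a χ x = r * lapGhost N m a φ x := by
  have hL : ∀ (b : ℝ) k y, b * ((N : ℝ) ^ 2 * latLap k χ y)
      = r * (b * ((N : ℝ) ^ 2 * latLap k φ y)) := by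
    intro b k y; simp only [latLap, h]; ring
  have hG : ∀ (b : ℝ) k y, b * ((N : ℝ) ^ 2 * latGrad k χ y)
      = r * (b * ((N : ℝ) ^ 2 * latGrad k φ y)) := by
    intro b k y; simp only [latGrad, h]; ring
  have hG' : ∀ k y, (N : ℝ) ^ 2 * latGrad k χ y = r * ((N : ℝ) ^ 2 * latGrad k φ y) := by
    intro k y; simp only [latGrad, h]; ring
  simp only [lapGhost, lapBulk, hL, hG, ← Finset.mul_sum]
  split_ifs <;> (try simp only [hG']) <;> ring

/-- The Laplacian with Robin boundary conditions, on functions on `⟦0, N⟧`. -/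
def robinGen (N m : ℕ) (a : ℕ → ℝ) (Am Ap : ℝ) :
    (Fin (N + 1) → ℝ) →ₗ[ℝ] (Fin (N + 1) → ℝ) where
  toFun φ x := lapGhost N m a (robinExt N Am Ap φ) ((x : ℕ) : ℤ)
  map_add' φ ψ := by
    funext x
    exact lapGhost_add N m a _ _ _ (robinExt_add N Am Ap φ ψ) _
  map_smul' r φ := by
    funext x
    exact lapGhost_smul N m a r _ _ (robinExt_smul N Am Ap r φ) _

/-- The heat kernel `𝒰_{S,T,x,y}` with coefficients `a` and Robin parameters `A₋, A₊`. -/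
def robinKernel (N m : ℕ) (a : ℕ → ℝ) (Am Ap : ℝ) (S T : ℝ) (x y : Fin (N + 1)) : ℝ :=
  (NormedSpace.exp ((T - S) • LinearMap.toMatrix' (robinGen N m a Am Ap)) :
    Matrix (Fin (N + 1)) (Fin (N + 1)) ℝ) x y

/-- The heat kernel `𝒰⁰` with Neumann boundary conditions, `A₋ = A₊ = 0`. -/
def neumannKernel (N m : ℕ) (a : ℕ → ℝ) (S T : ℝ) (x y : Fin (N + 1)) : ℝ :=
  robinKernel N m a 0 0 S T x y

/-- `𝒰_{S,S,x,y} = 1_{x=y}`. -/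
theorem robinKernel_self (N m : ℕ) (a : ℕ → ℝ) (Am Ap S : ℝ) (x y : Fin (N + 1)) :
    robinKernel N m a Am Ap S S x y = if x = y then 1 else 0 := by
  simp [robinKernel, Matrix.one_apply]

/-- `∂_T 𝒰_{S,T,x,y} = ℒ 𝒰_{S,T,x,y}`, with `ℒ` acting on `x` and the values at the ghost sites
given by the Robin boundary conditions. -/
theorem robinKernel_hasDerivAt (N m : ℕ) (a : ℕ → ℝ) (Am Ap S T : ℝ) (x y : Fin (N + 1)) :
    HasDerivAt (fun t => robinKernel N m a Am Ap S t x y)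
      (lapGhost N m a (robinExt N Am Ap fun z => robinKernel N m a Am Ap S T z y)
        ((x : ℕ) : ℤ)) T := by
  let _ : NormedRing (Matrix (Fin (N + 1)) (Fin (N + 1)) ℝ) := Matrix.linftyOpNormedRing
  let _ : NormedAlgebra ℝ (Matrix (Fin (N + 1)) (Fin (N + 1)) ℝ) := Matrix.linftyOpNormedAlgebra
  set G : Matrix (Fin (N + 1)) (Fin (N + 1)) ℝ := LinearMap.toMatrix' (robinGen N m a Am Ap) with hG
  have h1 : HasDerivAt (fun t : ℝ => NormedSpace.exp ((t - S) • G))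
      (G * NormedSpace.exp ((T - S) • G)) T := by
    have h := (hasDerivAt_exp_smul_const' (𝕂 := ℝ) G (T - S)).scomp T
      ((hasDerivAt_id T).sub_const S)
    rw [one_smul] at h
    exact h
  have h2 : HasDerivAt (fun t : ℝ => (NormedSpace.exp ((t - S) • G)) x y)
      ((G * NormedSpace.exp ((T - S) • G)) x y) T := by
    let ev : Matrix (Fin (N + 1)) (Fin (N + 1)) ℝ →ₗ[ℝ] ℝ := Matrix.entryLinearMap ℝ ℝ x y
    exact (LinearMap.toContinuousLinearMap ev).hasFDerivAt.comp_hasDerivAt T h1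
  have h3 : (G * NormedSpace.exp ((T - S) • G)) x y
      = lapGhost N m a (robinExt N Am Ap fun z => robinKernel N m a Am Ap S T z y)
        ((x : ℕ) : ℤ) := by
    have : (G * NormedSpace.exp ((T - S) • G)) x y
        = (G.mulVec fun z => NormedSpace.exp ((T - S) • G) z y) x := rfl
    rw [this, hG, LinearMap.toMatrix'_mulVec]
    rfl
  rw [← h3]
  exact h2

/-- The off-diagonal weight `exp[κ |x - y| / (N |T - S|^{1/2} ∨ 1)]`. -/
def offDiagWeight (N : ℕ) (κ S T : ℝ) (x y : Fin (N + 1)) : ℝ :=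
  Real.exp (κ * |((x : ℕ) : ℝ) - ((y : ℕ) : ℝ)| / max ((N : ℝ) * Real.sqrt |T - S|) 1)

/-- The on-diagonal bound `[N⁻¹ + N⁻¹ |T - S|^{-1/2}] ∧ 1`, which is `1` for `S = T`. -/
def onDiagBound (N : ℕ) (S T : ℝ) : ℝ :=
  if S = T then 1
  else min ((N : ℝ)⁻¹ + (N : ℝ)⁻¹ * |T - S| ^ (-(1 / 2) : ℝ)) 1

/-- The standing assumptions on the jump coefficients: `α_1, …, α_m > 0`, uniform ellipticity
`α_1 ≥ c`, the uniform second moment bound `∑ k² α_k ≤ C`, and `α̃_k ≥ 0`, so that the modified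
coefficients are jump rates of a random walk. -/
structure JumpCoeffs (N m : ℕ) (lam c C : ℝ) (α : ℕ → ℝ) : Prop where
  pos : ∀ k ∈ Finset.Icc 1 m, 0 < α k
  elliptic : c ≤ α 1
  moment : ∑ k ∈ Finset.Icc 1 m, (k : ℝ) ^ 2 * α k ≤ C
  mod_nonneg : ∀ k ∈ Finset.Icc 1 m, 0 ≤ modCoeff N m lam α k

end

/-! Each symmetric difference of range `k` is a triangular average of nearest neighbour second
differences, and cutting a jump at the boundary amounts to extending the function by constants
beyond the end points. Hence the bulk operator factorises as N² W Δ, where Δ is the nearest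
neighbour Neumann Laplacian (`pathLap`) and W (`fejerMatrix`) is symmetric, banded and nonnegative,
with diagonal bounded below by ellipticity. The product is not symmetric, but exp(t W Δ) W is, and
this replaces reversibility throughout.

The Robin terms, of either sign, are dominated entrywise by the same factorised form with a
potential d = β/N added to Δ at the two end points (`EllipticRates.robinMatrix_le`). Exponentials
are entrywise monotone, so it suffices to bound the kernel of A = W Δ_d, where Δ_d = Δ + d at the
ends, for times s up to order N².

Three estimates carry this. Exponential moments of the rows come from an explicit supersolution
whose slope at the ends absorbs the potential (`robinWeight`,
`EllipticRates.sum_exp_generator_mul_exp_le`); symmetry of exp(tA) W transfers them to the columns.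
The on-diagonal decay N⁻¹ + s^(-1/2) is Nash's argument for the diagonal of exp(2tA) W, whose
derivative is 2⟨f, Δ_d f⟩ with f a row of exp(tA) W
(`EllipticRates.exp_generator_mul_fejerMatrix_self_le`). Finally the kernel at time s is split at
s/2, with the pointwise bound on one factor and exponential moments on the other
(`mul_apply_mul_exp_le`).

For bounded N the modified rates may fail to be elliptic. There a crude row sum bound suffices,
since the claimed upper bound is then itself bounded below. -/

noncomputable section

open Matrix

/-! ### Exponentials of matrices with nonnegative off-diagonal entries. -/

section MatrixExp

variable {ι : Type*} [Fintype ι] [DecidableEq ι]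

theorem Matrix.hasSum_exp_apply (A : Matrix ι ι ℝ) (x y : ι) :
    HasSum (fun n : ℕ => ((n.factorial : ℝ)⁻¹) * (A ^ n) x y) (NormedSpace.exp A x y) := by
  let _ : NormedRing (Matrix ι ι ℝ) := Matrix.linftyOpNormedRing
  let _ : NormedAlgebra ℝ (Matrix ι ι ℝ) := Matrix.linftyOpNormedAlgebra
  have h := NormedSpace.exp_series_hasSum_exp' (𝕂 := ℝ) A
  let ev : Matrix ι ι ℝ →ₗ[ℝ] ℝ := Matrix.entryLinearMap ℝ ℝ x y
  exact (LinearMap.toContinuousLinearMap ev).hasSum h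

theorem Matrix.pow_apply_nonneg_le {A B : Matrix ι ι ℝ} (hA : ∀ x y, 0 ≤ A x y)
    (hAB : ∀ x y, A x y ≤ B x y) (n : ℕ) (x y : ι) :
    0 ≤ (A ^ n) x y ∧ (A ^ n) x y ≤ (B ^ n) x y := by
  induction n generalizing x y with
  | zero =>
    simp only [pow_zero, Matrix.one_apply]
    split_ifs <;> simp
  | succ n ih =>
    simp only [pow_succ, Matrix.mul_apply]
    refine ⟨Finset.sum_nonneg fun z _ => mul_nonneg (ih x z).1 (hA z y),
      Finset.sum_le_sum fun z _ => ?_⟩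
    exact mul_le_mul (ih x z).2 (hAB z y) (hA z y) ((ih x z).1.trans (ih x z).2)

theorem Matrix.exp_add_smul_one (A : Matrix ι ι ℝ) (r : ℝ) :
    NormedSpace.exp (A + r • (1 : Matrix ι ι ℝ)) = Real.exp r • NormedSpace.exp A := by
  have hc : Commute A (r • (1 : Matrix ι ι ℝ)) := (Commute.one_right A).smul_right r
  rw [Matrix.exp_add_of_commute _ _ hc]
  have : NormedSpace.exp (r • (1 : Matrix ι ι ℝ)) = Real.exp r • (1 : Matrix ι ι ℝ) := by
    rw [← Matrix.diagonal_one, ← Matrix.diagonal_smul, Matrix.exp_diagonal,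
      ← Matrix.diagonal_smul]
    congr 1
    funext i
    rw [Pi.coe_exp]
    simp [Real.exp_eq_exp_ℝ]
  rw [this]
  simp

/-- Exponentials of matrices with nonnegative off-diagonal entries are entrywise nonnegative and
entrywise monotone. -/
theorem Matrix.exp_apply_nonneg_le {A B : Matrix ι ι ℝ} (hA : ∀ x y, x ≠ y → 0 ≤ A x y)
    (hAB : ∀ x y, A x y ≤ B x y) (x y : ι) :
    0 ≤ NormedSpace.exp A x y ∧ NormedSpace.exp A x y ≤ NormedSpace.exp B x y := by
  -- Adding `r` times the identity makes all entries nonnegative, so the power series compare term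
  -- by term; it only multiplies both exponentials by the same scalar.
  set r : ℝ := ∑ z, |A z z| with hr
  have hr' : ∀ z, 0 ≤ A z z + r := by
    intro z
    have h1 : |A z z| ≤ r :=
      Finset.single_le_sum (f := fun z => |A z z|) (fun i _ => abs_nonneg _) (Finset.mem_univ z)
    linarith [neg_abs_le (A z z)]
  have hA1 : ∀ u v, 0 ≤ (A + r • (1 : Matrix ι ι ℝ)) u v := by
    intro u v
    by_cases h : u = v
    · subst h; simpa using hr' u
    · simpa [Matrix.one_apply, h] using hA u v h
  have hB1 : ∀ u v, (A + r • (1 : Matrix ι ι ℝ)) u v ≤ (B + r • (1 : Matrix ι ι ℝ)) u v := by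
    intro u v
    simpa using hAB u v
  have hsA := Matrix.hasSum_exp_apply (A + r • (1 : Matrix ι ι ℝ)) x y
  have hsB := Matrix.hasSum_exp_apply (B + r • (1 : Matrix ι ι ℝ)) x y
  have hpos : ∀ n : ℕ, (0 : ℝ) ≤ ((n.factorial : ℝ)⁻¹) := fun n => by positivity
  have h0 := hsA.nonneg fun n => mul_nonneg (hpos n) (Matrix.pow_apply_nonneg_le hA1 hB1 n x y).1
  have h1 := hasSum_le (fun n => mul_le_mul_of_nonneg_left
    (Matrix.pow_apply_nonneg_le hA1 hB1 n x y).2 (hpos n)) hsA hsB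
  rw [Matrix.exp_add_smul_one] at h0 h1
  rw [Matrix.exp_add_smul_one] at h1
  simp only [Matrix.smul_apply, smul_eq_mul] at h0 h1
  exact ⟨nonneg_of_mul_nonneg_right h0 (Real.exp_pos r),
    le_of_mul_le_mul_left h1 (Real.exp_pos r)⟩

theorem Matrix.hasDerivAt_exp_smul_apply (A : Matrix ι ι ℝ) (t : ℝ) (x y : ι) :
    HasDerivAt (fun t : ℝ => NormedSpace.exp (t • A) x y)
      ((NormedSpace.exp (t • A) * A) x y) t := by
  let _ : NormedRing (Matrix ι ι ℝ) := Matrix.linftyOpNormedRing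
  let _ : NormedAlgebra ℝ (Matrix ι ι ℝ) := Matrix.linftyOpNormedAlgebra
  have h := hasDerivAt_exp_smul_const (𝕂 := ℝ) A t
  let ev : Matrix ι ι ℝ →ₗ[ℝ] ℝ := Matrix.entryLinearMap ℝ ℝ x y
  exact (LinearMap.toContinuousLinearMap ev).hasFDerivAt.comp_hasDerivAt t h

theorem Matrix.exp_smul_add (A : Matrix ι ι ℝ) (s t : ℝ) :
    NormedSpace.exp ((s + t) • A) = NormedSpace.exp (s • A) * NormedSpace.exp (t • A) := by
  rw [add_smul]
  exact Matrix.exp_add_of_commute _ _ (((Commute.refl A).smul_left s).smul_right t)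

/-- Intertwining passes to powers, hence to the exponential. With `B` the transpose of `A` and `W`
symmetric it makes exp(A) W symmetric. -/
theorem Matrix.exp_mul_of_mul_eq {A B W : Matrix ι ι ℝ} (h : A * W = W * B) :
    NormedSpace.exp A * W = W * NormedSpace.exp B := by
  have hp : ∀ n : ℕ, A ^ n * W = W * B ^ n := by
    intro n
    induction n with
    | zero => simp
    | succ n ih => rw [pow_succ, pow_succ', Matrix.mul_assoc, h, ← Matrix.mul_assoc, ih,
        Matrix.mul_assoc, ← pow_succ, ← pow_succ']
  ext x y
  have h1 : HasSum (fun n : ℕ => ∑ z, (((n.factorial : ℝ)⁻¹) * (A ^ n) x z) * W z y)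
      ((NormedSpace.exp A * W) x y) :=
    hasSum_sum fun z _ => (Matrix.hasSum_exp_apply A x z).mul_right _
  have h2 : HasSum (fun n : ℕ => ∑ z, W x z * (((n.factorial : ℝ)⁻¹) * (B ^ n) z y))
      ((W * NormedSpace.exp B) x y) :=
    hasSum_sum fun z _ => (Matrix.hasSum_exp_apply B z y).mul_left _
  refine h1.unique ?_
  convert h2 using 2 with n
  have := congrFun (congrFun (hp n) x) y
  simp only [Matrix.mul_apply] at this
  calc _ = ((n.factorial : ℝ)⁻¹) * ∑ z, (A ^ n) x z * W z y := by
        rw [Finset.mul_sum]; exact Finset.sum_congr rfl fun z _ => by ring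
    _ = _ := by
        rw [this, Finset.mul_sum]; exact Finset.sum_congr rfl fun z _ => by ring

/-- A supersolution `A φ ≤ r φ` bounds the semigroup generated by `A`. -/
theorem Matrix.sum_exp_smul_mul_le {A : Matrix ι ι ℝ} (hA : ∀ x y, x ≠ y → 0 ≤ A x y)
    {φ : ι → ℝ} {r : ℝ} (hφ : ∀ x, ∑ y, A x y * φ y ≤ r * φ x) {t : ℝ} (ht : 0 ≤ t) (x : ι) :
    ∑ y, NormedSpace.exp (t • A) x y * φ y ≤ Real.exp (r * t) * φ x := by
  have hnn : ∀ s : ℝ, 0 ≤ s → ∀ u v, 0 ≤ NormedSpace.exp (s • A) u v := by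
    intro s hs u v
    refine (Matrix.exp_apply_nonneg_le (A := s • A) (B := s • A) (fun u v h => ?_)
      (fun _ _ => le_rfl) u v).1
    simpa using mul_nonneg hs (hA u v h)
  -- Grönwall: the derivative of `H` is e^{-rs} times the semigroup applied to Aφ - rφ ≤ 0, and the
  -- semigroup preserves signs.
  let H : ℝ → ℝ := fun s => Real.exp (-r * s) * ∑ y, NormedSpace.exp (s • A) x y * φ y
  have hd : ∀ s, HasDerivAt H
      (Real.exp (-r * s) * ∑ y, NormedSpace.exp (s • A) x y * ((∑ z, A y z * φ z) - r * φ y)) s := by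
    intro s
    have h1 : HasDerivAt (fun s : ℝ => Real.exp (-r * s)) (Real.exp (-r * s) * (-r)) s := by
      simpa using ((hasDerivAt_id s).const_mul (-r)).exp
    have h2 : HasDerivAt (fun s : ℝ => ∑ y, NormedSpace.exp (s • A) x y * φ y)
        (∑ y, (NormedSpace.exp (s • A) * A) x y * φ y) s :=
      HasDerivAt.fun_sum fun y _ => (Matrix.hasDerivAt_exp_smul_apply A s x y).mul_const _
    have h3 := h1.fun_mul h2
    have h4 : ∑ y, (NormedSpace.exp (s • A) * A) x y * φ y
        = ∑ y, NormedSpace.exp (s • A) x y * ∑ z, A y z * φ z := by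
      simp only [Matrix.mul_apply, Finset.sum_mul, Finset.mul_sum]
      rw [Finset.sum_comm]
      exact Finset.sum_congr rfl fun _ _ => Finset.sum_congr rfl fun _ _ => by ring
    refine h3.congr_deriv ?_
    rw [h4]
    simp only [mul_sub, Finset.sum_sub_distrib]
    have : ∑ y, NormedSpace.exp (s • A) x y * (r * φ y)
        = r * ∑ y, NormedSpace.exp (s • A) x y * φ y := by
      rw [Finset.mul_sum]; exact Finset.sum_congr rfl fun _ _ => by ring
    rw [this]; ring
  have hanti : AntitoneOn H (Set.Ici 0) := by
    refine antitoneOn_of_deriv_nonpos (convex_Ici 0)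
      (fun s _ => (hd s).continuousAt.continuousWithinAt)
      (fun s _ => (hd s).differentiableAt.differentiableWithinAt) fun s hs => ?_
    rw [interior_Ici] at hs
    rw [(hd s).deriv]
    refine mul_nonpos_of_nonneg_of_nonpos (Real.exp_pos _).le (Finset.sum_nonpos fun y _ => ?_)
    exact mul_nonpos_of_nonneg_of_nonpos (hnn s (le_of_lt hs) x y) (by linarith [hφ y])
  have h := hanti (Set.mem_Ici.2 le_rfl) (Set.mem_Ici.2 ht) ht
  have h0 : H 0 = φ x := by
    simp [H, Matrix.one_apply]
  rw [h0] at h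
  have h5 : Real.exp (r * t) * H t = ∑ y, NormedSpace.exp (t • A) x y * φ y := by
    simp only [H]
    rw [← mul_assoc, ← Real.exp_add]
    simp
  rw [← h5]
  exact mul_le_mul_of_nonneg_left h (Real.exp_pos _).le

end MatrixExp

/-! ### Factorisation of the generator through nearest neighbour differences. -/

/-- The point of `⟦0, N⟧` closest to `z`. -/
def clampFin (N : ℕ) (z : ℤ) : Fin (N + 1) := ⟨(min (max z 0) N).toNat, by omega⟩

theorem clampFin_coe (N : ℕ) (x : Fin (N + 1)) : clampFin N ((x : ℕ) : ℤ) = x := by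
  ext; simp only [clampFin]; omega

theorem clampFin_of_nonpos {N : ℕ} {z : ℤ} (hz : z ≤ 0) : clampFin N z = 0 := by
  ext; simp only [clampFin, Fin.val_zero]; omega

theorem clampFin_of_le {N : ℕ} {z : ℤ} (hz : (N : ℤ) ≤ z) : clampFin N z = Fin.last N := by
  ext; simp only [clampFin, Fin.val_last]; omega

/-- The kernel `½ ∑_k a_k (k - |i|)₊`, which carries second differences of step one to the
combination `½ ∑_k a_k Δ_k`. -/
def fejerWeight (m : ℕ) (a : ℕ → ℝ) (i : ℤ) : ℝ :=
  (1 / 2) * ∑ k ∈ Finset.Icc 1 m, a k * max ((k : ℝ) - |(i : ℝ)|) 0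

/-- The Toeplitz matrix of `fejerWeight` on `⟦0, N⟧`. -/
def fejerMatrix (N m : ℕ) (a : ℕ → ℝ) : Matrix (Fin (N + 1)) (Fin (N + 1)) ℝ :=
  fun x y => fejerWeight m a (((x : ℕ) : ℤ) - ((y : ℕ) : ℤ))

/-- The nearest neighbour Neumann Laplacian on `⟦0, N⟧`, plus the potential `d` at the two end
points. -/
def pathLap (N : ℕ) (d : ℝ) : Matrix (Fin (N + 1)) (Fin (N + 1)) ℝ := fun x y =>
  (if clampFin N (((x : ℕ) : ℤ) + 1) = y then 1 else 0)
    + (if clampFin N (((x : ℕ) : ℤ) - 1) = y then 1 else 0) - (if x = y then 2 else 0)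
    + (if x = y then ((if x = 0 then d else 0) + (if x = Fin.last N then d else 0)) else 0)

theorem pathLap_mulVec (N : ℕ) (d : ℝ) (φ : Fin (N + 1) → ℝ) (x : Fin (N + 1)) :
    ∑ y, pathLap N d x y * φ y
      = latLap 1 (fun z => φ (clampFin N z)) ((x : ℕ) : ℤ)
        + ((if x = 0 then d * φ x else 0) + (if x = Fin.last N then d * φ x else 0)) := by
  simp only [pathLap, add_mul, sub_mul, Finset.sum_add_distrib, Finset.sum_sub_distrib, ite_mul,
    one_mul, zero_mul, Finset.sum_ite_eq, Finset.mem_univ, if_true, latLap, clampFin_coe]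

theorem pathLap_symm (N : ℕ) (d : ℝ) (x y : Fin (N + 1)) : pathLap N d x y = pathLap N d y x := by
  by_cases hxy : x = y
  · rw [hxy]
  have hne : (x : ℕ) ≠ (y : ℕ) := fun h => hxy (Fin.ext h)
  have hx := x.2
  have hy := y.2
  have h1 : (clampFin N (((x : ℕ) : ℤ) + 1) = y) ↔ (x : ℕ) + 1 = y := by
    rw [Fin.ext_iff]; simp only [clampFin]; omega
  have h2 : (clampFin N (((x : ℕ) : ℤ) - 1) = y) ↔ (y : ℕ) + 1 = x := by
    rw [Fin.ext_iff]; simp only [clampFin]; omega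
  have h3 : (clampFin N (((y : ℕ) : ℤ) + 1) = x) ↔ (y : ℕ) + 1 = x := by
    rw [Fin.ext_iff]; simp only [clampFin]; omega
  have h4 : (clampFin N (((y : ℕ) : ℤ) - 1) = x) ↔ (x : ℕ) + 1 = y := by
    rw [Fin.ext_iff]; simp only [clampFin]; omega
  simp only [pathLap, h1, h2, h3, h4, hxy, Ne.symm hxy, if_false]
  ring

theorem fejerWeight_neg (m : ℕ) (a : ℕ → ℝ) (i : ℤ) : fejerWeight m a (-i) = fejerWeight m a i := by
  simp [fejerWeight]

theorem fejerMatrix_symm (N m : ℕ) (a : ℕ → ℝ) (x y : Fin (N + 1)) :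
    fejerMatrix N m a x y = fejerMatrix N m a y x := by
  simp only [fejerMatrix]
  rw [← fejerWeight_neg, neg_sub]

theorem sum_latLap_one (Ψ : ℤ → ℝ) (x : ℤ) (k : ℕ) :
    ∑ z ∈ Finset.Icc (x - k) (x + k), latLap 1 Ψ z
      = (Ψ (x + k + 1) - Ψ (x + k)) - (Ψ (x - k) - Ψ (x - k - 1)) := by
  induction k with
  | zero => simp [latLap]; ring
  | succ k ih =>
    have hI : Finset.Icc (x - ((k + 1 : ℕ) : ℤ)) (x + ((k + 1 : ℕ) : ℤ))
        = insert (x - k - 1) (insert (x + k + 1) (Finset.Icc (x - k) (x + k))) := by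
      ext z; simp only [Finset.mem_Icc, Finset.mem_insert]; push_cast; omega
    rw [hI, Finset.sum_insert (by simp only [Finset.mem_Icc, Finset.mem_insert]; omega),
      Finset.sum_insert (by simp only [Finset.mem_Icc]; omega), ih]
    simp only [latLap]
    push_cast
    rw [show x + k + 1 - 1 = x + k by ring, show x - k - 1 + 1 = x - k by ring,
      show x + (k + 1) + 1 = x + k + 1 + 1 by ring, show x + ((k : ℤ) + 1) = x + k + 1 by ring,
      show x - ((k : ℤ) + 1) = x - k - 1 by ring]
    ring

/-- Raising `k` by one raises the weight by one on the old window, while the two new end points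
carry weight zero. The increment is therefore the telescoping sum `sum_latLap_one`. -/
theorem sum_triangle_mul_latLap (Ψ : ℤ → ℝ) (x : ℤ) (k : ℕ) :
    ∑ z ∈ Finset.Icc (x - k) (x + k), ((k : ℝ) - |((x - z : ℤ) : ℝ)|) * latLap 1 Ψ z
      = latLap k Ψ x := by
  induction k with
  | zero => simp [latLap]; ring
  | succ k ih =>
    have hI : Finset.Icc (x - ((k + 1 : ℕ) : ℤ)) (x + ((k + 1 : ℕ) : ℤ))
        = insert (x - k - 1) (insert (x + k + 1) (Finset.Icc (x - k) (x + k))) := by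
      ext z; simp only [Finset.mem_Icc, Finset.mem_insert]; push_cast; omega
    rw [hI, Finset.sum_insert (by simp only [Finset.mem_Icc, Finset.mem_insert]; omega),
      Finset.sum_insert (by simp only [Finset.mem_Icc]; omega)]
    have e1 : (((k + 1 : ℕ) : ℝ) - |((x - (x - k - 1) : ℤ) : ℝ)|) = 0 := by
      rw [show x - (x - (k : ℤ) - 1) = k + 1 by ring]
      push_cast
      rw [abs_of_nonneg (by positivity)]; ring
    have e2 : (((k + 1 : ℕ) : ℝ) - |((x - (x + k + 1) : ℤ) : ℝ)|) = 0 := by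
      rw [show x - (x + (k : ℤ) + 1) = -(k + 1) by ring]
      push_cast
      rw [abs_neg, abs_of_nonneg (by positivity)]; ring
    rw [e1, e2, zero_mul, zero_mul, zero_add, zero_add]
    have e3 : ∀ z ∈ Finset.Icc (x - k) (x + k),
        (((k + 1 : ℕ) : ℝ) - |((x - z : ℤ) : ℝ)|) * latLap 1 Ψ z
          = ((k : ℝ) - |((x - z : ℤ) : ℝ)|) * latLap 1 Ψ z + latLap 1 Ψ z := by
      intro z _; push_cast; ring
    rw [Finset.sum_congr rfl e3, Finset.sum_add_distrib, ih, sum_latLap_one]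
    simp only [latLap]
    push_cast
    rw [show x + ((k : ℤ) + 1) = x + k + 1 by ring, show x - ((k : ℤ) + 1) = x - k - 1 by ring]
    ring

theorem sum_fin_eq_sum_Icc (N : ℕ) (h : ℤ → ℝ) :
    ∑ z : Fin (N + 1), h ((z : ℕ) : ℤ) = ∑ z ∈ Finset.Icc (0 : ℤ) N, h z := by
  refine Finset.sum_bij (fun z _ => ((z : ℕ) : ℤ)) ?_ ?_ ?_ (fun _ _ => rfl)
  · intro z _; have := z.2; simp only [Finset.mem_Icc]; omega
  · intro y _ z _ h; ext; exact_mod_cast h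
  · intro z hz
    rw [Finset.mem_Icc] at hz
    exact ⟨⟨z.toNat, by omega⟩, Finset.mem_univ _, by simp only; omega⟩

/-- The extension by `clampFin` is constant outside `⟦0, N⟧`, so its second differences vanish there
and the triangular sum may be restricted to the segment. -/
theorem sum_triangle_mul_pathLap (N k : ℕ) (φ : Fin (N + 1) → ℝ) (x : Fin (N + 1)) :
    ∑ z : Fin (N + 1), max ((k : ℝ) - |(((((x : ℕ) : ℤ) - ((z : ℕ) : ℤ)) : ℤ) : ℝ)|) 0
        * latLap 1 (fun z => φ (clampFin N z)) ((z : ℕ) : ℤ)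
      = latLap k (fun z => φ (clampFin N z)) ((x : ℕ) : ℤ) := by
  set Ψ : ℤ → ℝ := fun z => φ (clampFin N z) with hΨ
  set X : ℤ := ((x : ℕ) : ℤ) with hX
  have hx := x.2
  rw [sum_fin_eq_sum_Icc N fun z => max ((k : ℝ) - |((X - z : ℤ) : ℝ)|) 0 * latLap 1 Ψ z]
  rw [← sum_triangle_mul_latLap Ψ X k]
  have hz0 : ∀ z : ℤ, z ∉ Finset.Icc (0 : ℤ) N → latLap 1 Ψ z = 0 := by
    intro z hz
    simp only [Finset.mem_Icc, not_and_or, not_le] at hz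
    simp only [latLap, hΨ]
    rcases hz with hz | hz
    · rw [clampFin_of_nonpos (by omega), clampFin_of_nonpos (by omega),
        clampFin_of_nonpos (by omega)]; ring
    · rw [clampFin_of_le (by omega), clampFin_of_le (by omega), clampFin_of_le (by omega)]; ring
  have hw0 : ∀ z : ℤ, z ∉ Finset.Icc (X - k) (X + k) →
      max ((k : ℝ) - |((X - z : ℤ) : ℝ)|) 0 = 0 := by
    intro z hz
    apply max_eq_right
    have : (k : ℤ) ≤ |X - z| := by
      simp only [Finset.mem_Icc, not_and_or, not_le] at hz
      rw [le_abs]; omega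
    have h2 : ((k : ℤ) : ℝ) ≤ ((|X - z| : ℤ) : ℝ) := by exact_mod_cast this
    push_cast at h2 ⊢
    linarith
  have hw1 : ∀ z ∈ Finset.Icc (X - k) (X + k),
      max ((k : ℝ) - |((X - z : ℤ) : ℝ)|) 0 = (k : ℝ) - |((X - z : ℤ) : ℝ)| := by
    intro z hz
    apply max_eq_left
    have : |X - z| ≤ (k : ℤ) := by
      simp only [Finset.mem_Icc] at hz
      rw [abs_le]; omega
    have h2 : ((|X - z| : ℤ) : ℝ) ≤ ((k : ℤ) : ℝ) := by exact_mod_cast this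
    push_cast at h2 ⊢
    linarith
  calc ∑ z ∈ Finset.Icc (0 : ℤ) N, max ((k : ℝ) - |((X - z : ℤ) : ℝ)|) 0 * latLap 1 Ψ z
      = ∑ z ∈ Finset.Icc (0 : ℤ) N ∪ Finset.Icc (X - k) (X + k),
          max ((k : ℝ) - |((X - z : ℤ) : ℝ)|) 0 * latLap 1 Ψ z :=
        Finset.sum_subset Finset.subset_union_left fun z _ hz => by rw [hz0 z hz, mul_zero]
    _ = ∑ z ∈ Finset.Icc (X - k) (X + k),
          max ((k : ℝ) - |((X - z : ℤ) : ℝ)|) 0 * latLap 1 Ψ z :=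
        (Finset.sum_subset Finset.subset_union_right fun z _ hz => by
          rw [hw0 z hz, zero_mul]).symm
    _ = _ := Finset.sum_congr rfl fun z hz => by rw [hw1 z hz]

/-- The action of `W Δ`, with `W` the Fejér matrix and `Δ` the nearest neighbour Neumann
Laplacian. -/
theorem fejerMatrix_mul_pathLap_mulVec (N m : ℕ) (a : ℕ → ℝ) (φ : Fin (N + 1) → ℝ)
    (x : Fin (N + 1)) :
    ∑ y, (fejerMatrix N m a * pathLap N 0) x y * φ y
      = (1 / 2) * ∑ k ∈ Finset.Icc 1 m,
          a k * latLap k (fun z => φ (clampFin N z)) ((x : ℕ) : ℤ) := by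
  have h1 : ∑ y, (fejerMatrix N m a * pathLap N 0) x y * φ y
      = ∑ z, fejerMatrix N m a x z * ∑ y, pathLap N 0 z y * φ y := by
    simp only [Matrix.mul_apply, Finset.sum_mul, Finset.mul_sum]
    rw [Finset.sum_comm]
    exact Finset.sum_congr rfl fun _ _ => Finset.sum_congr rfl fun _ _ => by ring
  rw [h1]
  simp only [pathLap_mulVec, zero_mul, ite_self, add_zero, fejerMatrix, fejerWeight]
  simp_rw [← sum_triangle_mul_pathLap N _ φ x]
  simp only [Finset.sum_mul, Finset.mul_sum]
  rw [Finset.sum_comm]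
  exact Finset.sum_congr rfl fun _ _ => Finset.sum_congr rfl fun _ _ => by ring

theorem robinExt_eq_clampFin {N : ℕ} (Am Ap : ℝ) (φ : Fin (N + 1) → ℝ) {z : ℤ} (h0 : 0 ≤ z)
    (hN : z ≤ N) : robinExt N Am Ap φ z = φ (clampFin N z) := by
  unfold robinExt
  rw [if_neg (by omega), if_neg (by omega), dif_pos ⟨h0, hN⟩]
  congr 1
  ext; simp only [clampFin]; omega

theorem robinExt_neg_one (N : ℕ) (Am Ap : ℝ) (φ : Fin (N + 1) → ℝ) :
    robinExt N Am Ap φ (-1) = (1 - Am / (N : ℝ)) * φ 0 := by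
  unfold robinExt
  rw [if_pos rfl]

theorem robinExt_succ_last (N : ℕ) (Am Ap : ℝ) (φ : Fin (N + 1) → ℝ) :
    robinExt N Am Ap φ ((N : ℤ) + 1) = (1 - Ap / (N : ℝ)) * φ (Fin.last N) := by
  unfold robinExt
  rw [if_neg (by omega), if_pos rfl]

/-- A jump cut at the boundary lands where `clampFin` sends the uncut jump. Since 2m ≤ N + 1, the
two boundary zones are disjoint and the uncut jumps in them stay inside the segment, so no ghost
value enters. -/
theorem lapBulk_robinExt {N m : ℕ} (hm : 1 ≤ m) (hN : 2 * m ≤ N + 1) (a : ℕ → ℝ) (Am Ap : ℝ)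
    (φ : Fin (N + 1) → ℝ) (x : Fin (N + 1)) :
    lapBulk N m a (robinExt N Am Ap φ) ((x : ℕ) : ℤ)
      = (N : ℝ) ^ 2 * ∑ y, (fejerMatrix N m a * pathLap N 0) x y * φ y := by
  rw [fejerMatrix_mul_pathLap_mulVec]
  have hx := x.2
  set X : ℤ := ((x : ℕ) : ℤ) with hX
  have hpt : ∀ z : ℤ, 0 ≤ z → z ≤ N → robinExt N Am Ap φ z = φ (clampFin N z) :=
    fun z => robinExt_eq_clampFin Am Ap φ
  have hlow : ∀ k : ℕ, clampFin N (X - k) = clampFin N (X + -(min (k : ℤ) X)) := by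
    intro k; ext; simp only [clampFin]; omega
  have hhigh : ∀ k : ℕ, clampFin N (X + k) = clampFin N (X + min (k : ℤ) (N - X)) := by
    intro k; ext; simp only [clampFin]; omega
  unfold lapBulk
  by_cases hl : X ≤ (m : ℤ) - 1
  · rw [if_neg (by omega), if_pos (by omega), if_neg (by omega)]
    simp only [Finset.mul_sum, ← Finset.sum_add_distrib, zero_add, add_zero]
    refine Finset.sum_congr rfl fun k hk => ?_
    rw [Finset.mem_Icc] at hk
    simp only [latGrad, latLap]
    rw [hpt X (by omega) (by omega), hpt _ (by omega) (by omega), hpt _ (by omega) (by omega),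
      hlow k]
    ring
  by_cases hr : (N : ℤ) - m + 1 ≤ X
  · rw [if_neg (by omega), if_neg (by omega), if_pos (by omega)]
    simp only [Finset.mul_sum, ← Finset.sum_add_distrib, zero_add]
    refine Finset.sum_congr rfl fun k hk => ?_
    rw [Finset.mem_Icc] at hk
    simp only [latGrad, latLap]
    rw [hpt X (by omega) (by omega), hpt _ (by omega) (by omega), hpt _ (by omega) (by omega),
      hhigh k, ← sub_eq_add_neg]
    ring
  · rw [if_pos (by omega), if_neg (by omega), if_neg (by omega)]
    simp only [Finset.mul_sum, add_zero]
    refine Finset.sum_congr rfl fun k hk => ?_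
    rw [Finset.mem_Icc] at hk
    simp only [latLap]
    rw [hpt X (by omega) (by omega), hpt _ (by omega) (by omega), hpt _ (by omega) (by omega)]
    ring

/-- The matrix of the Robin Laplacian. -/
def robinMatrix (N m : ℕ) (a : ℕ → ℝ) (Am Ap : ℝ) : Matrix (Fin (N + 1)) (Fin (N + 1)) ℝ :=
  fun x y => (N : ℝ) ^ 2 * (fejerMatrix N m a * pathLap N 0) x y
    + (if x = y then ((if x = 0 then -(N * Am) else 0) + (if x = Fin.last N then -(N * Ap) else 0))
        else 0)

theorem toMatrix'_robinGen {N m : ℕ} (hm : 1 ≤ m) (hN : 2 * m ≤ N + 1) (a : ℕ → ℝ) (Am Ap : ℝ) :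
    LinearMap.toMatrix' (robinGen N m a Am Ap) = robinMatrix N m a Am Ap := by
  have hN0 : (N : ℝ) ≠ 0 := by
    have : N ≠ 0 := by omega
    exact_mod_cast this
  have : robinGen N m a Am Ap = Matrix.toLin' (robinMatrix N m a Am Ap) := by
    refine LinearMap.ext fun φ => funext fun x => ?_
    have hx := x.2
    change lapGhost N m a (robinExt N Am Ap φ) ((x : ℕ) : ℤ) = _
    rw [Matrix.toLin'_apply, Matrix.mulVec, dotProduct]
    simp only [robinMatrix, add_mul, Finset.sum_add_distrib, ite_mul, zero_mul, Finset.sum_ite_eq,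
      Finset.mem_univ, if_true, mul_assoc, ← Finset.mul_sum]
    unfold lapGhost
    rw [lapBulk_robinExt hm hN, add_assoc]
    congr 1
    have h0 : ((x : ℕ) : ℤ) = 0 ↔ x = 0 := by
      rw [Fin.ext_iff, Fin.val_zero]; omega
    have h1 : ((x : ℕ) : ℤ) = N ↔ x = Fin.last N := by
      rw [Fin.ext_iff, Fin.val_last]; omega
    simp only [h0, h1]
    congr 1
    · split_ifs with h
      · subst h
        simp only [latGrad]
        rw [robinExt_eq_clampFin (z := (((0 : Fin (N + 1)) : ℕ) : ℤ)) _ _ _ (by simp) (by simp),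
          clampFin_coe]
        rw [show (((0 : Fin (N + 1)) : ℕ) : ℤ) + -1 = -1 by simp, robinExt_neg_one]
        field_simp
        ring
      · rfl
    · split_ifs with h
      · subst h
        simp only [latGrad]
        rw [robinExt_eq_clampFin (z := (((Fin.last N : Fin (N + 1)) : ℕ) : ℤ)) _ _ _ (by simp)
          (by simp), clampFin_coe]
        rw [Fin.val_last, robinExt_succ_last]
        field_simp
        ring
      · rfl
  rw [this, LinearMap.toMatrix'_toLin']

/-! ### Bounds on the Fejér matrix from ellipticity and the second moment. -/

/-- Nonnegative rates `a_1, …, a_m` with `c ≤ a_1` and second moment at most `C`. -/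
structure EllipticRates (m : ℕ) (c C : ℝ) (a : ℕ → ℝ) : Prop where
  nonneg : ∀ k ∈ Finset.Icc 1 m, 0 ≤ a k
  elliptic : c ≤ a 1
  moment : ∑ k ∈ Finset.Icc 1 m, (k : ℝ) ^ 2 * a k ≤ C

section Fejer

variable {N m : ℕ} {c C : ℝ} {a : ℕ → ℝ}

theorem fejerWeight_nonneg (ha : ∀ k ∈ Finset.Icc 1 m, 0 ≤ a k) (i : ℤ) : 0 ≤ fejerWeight m a i :=
  mul_nonneg (by norm_num) (Finset.sum_nonneg fun k hk => mul_nonneg (ha k hk) (le_max_right _ _))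

theorem fejerWeight_eq_zero {i : ℤ} (hi : (m : ℤ) ≤ |i|) : fejerWeight m a i = 0 := by
  unfold fejerWeight
  rw [Finset.sum_eq_zero, mul_zero]
  intro k hk
  rw [Finset.mem_Icc] at hk
  have h1 : ((m : ℤ) : ℝ) ≤ ((|i| : ℤ) : ℝ) := by exact_mod_cast hi
  have h2 : (k : ℝ) ≤ m := by exact_mod_cast hk.2
  push_cast at h1
  rw [max_eq_right (by linarith), mul_zero]

theorem EllipticRates.moment_nonneg (h : EllipticRates m c C a) : 0 ≤ C :=
  (Finset.sum_nonneg fun k hk => mul_nonneg (sq_nonneg _) (h.nonneg k hk)).trans h.moment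

theorem EllipticRates.fejerWeight_le (h : EllipticRates m c C a) (i : ℤ) :
    fejerWeight m a i ≤ C := by
  have h1 : ∑ k ∈ Finset.Icc 1 m, a k * max ((k : ℝ) - |(i : ℝ)|) 0
      ≤ ∑ k ∈ Finset.Icc 1 m, (k : ℝ) ^ 2 * a k := by
    refine Finset.sum_le_sum fun k hk => ?_
    rw [mul_comm]
    refine mul_le_mul_of_nonneg_right ?_ (h.nonneg k hk)
    rw [Finset.mem_Icc] at hk
    have hk1 : (1 : ℝ) ≤ k := by exact_mod_cast hk.1
    refine max_le ?_ (sq_nonneg _)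
    nlinarith [abs_nonneg (i : ℝ)]
  have h2 := h.moment
  have h3 := h.moment_nonneg
  unfold fejerWeight
  linarith

/-- Only the term `k = 1` is kept. This is where ellipticity enters. -/
theorem EllipticRates.le_fejerWeight_zero (hm : 1 ≤ m) (h : EllipticRates m c C a) :
    c / 2 ≤ fejerWeight m a 0 := by
  have h1 : a 1 * max (((1 : ℕ) : ℝ) - |((0 : ℤ) : ℝ)|) 0
      ≤ ∑ k ∈ Finset.Icc 1 m, a k * max ((k : ℝ) - |((0 : ℤ) : ℝ)|) 0 :=
    Finset.single_le_sum (f := fun k : ℕ => a k * max ((k : ℝ) - |((0 : ℤ) : ℝ)|) 0)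
      (fun k hk => mul_nonneg (h.nonneg k hk) (le_max_right _ _))
      (Finset.mem_Icc.2 ⟨le_rfl, hm⟩)
  have h2 := h.elliptic
  simp only [Nat.cast_one, Int.cast_zero, abs_zero, sub_zero, zero_le_one, max_eq_left,
    mul_one] at h1
  unfold fejerWeight
  simp only [Int.cast_zero, abs_zero, sub_zero]
  linarith

theorem EllipticRates.fejerMatrix_nonneg (h : EllipticRates m c C a) (x y : Fin (N + 1)) :
    0 ≤ fejerMatrix N m a x y := fejerWeight_nonneg h.nonneg _

theorem EllipticRates.le_fejerMatrix_self (hm : 1 ≤ m) (h : EllipticRates m c C a)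
    (x : Fin (N + 1)) : c / 2 ≤ fejerMatrix N m a x x := by
  simpa [fejerMatrix] using h.le_fejerWeight_zero hm

/-- A row has at most 2m + 1 nonzero entries, each at most `C`. -/
theorem EllipticRates.sum_fejerMatrix_mul_le (h : EllipticRates m c C a) (x : Fin (N + 1))
    {φ : Fin (N + 1) → ℝ} {M : ℝ} (hM : 0 ≤ M)
    (hφ : ∀ z : Fin (N + 1), |((x : ℕ) : ℝ) - ((z : ℕ) : ℝ)| ≤ m → φ z ≤ M) :
    ∑ z, fejerMatrix N m a x z * φ z ≤ (2 * m + 1) * C * M := by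
  have hC := h.moment_nonneg
  have h1 : ∀ z : Fin (N + 1), fejerMatrix N m a x z * φ z
      ≤ (fun z : ℤ => if z ∈ Finset.Icc (((x : ℕ) : ℤ) - m) (((x : ℕ) : ℤ) + m) then C * M else 0)
        ((z : ℕ) : ℤ) := by
    intro z
    simp only
    split_ifs with hz
    · rw [Finset.mem_Icc] at hz
      have h2 : |((x : ℕ) : ℤ) - ((z : ℕ) : ℤ)| ≤ m := by rw [abs_le]; omega
      have h3 : |((x : ℕ) : ℝ) - ((z : ℕ) : ℝ)| ≤ m := by exact_mod_cast h2
      exact (mul_le_mul_of_nonneg_left (hφ z h3) (h.fejerMatrix_nonneg x z)).trans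
        (mul_le_mul_of_nonneg_right (h.fejerWeight_le _) hM)
    · have : fejerMatrix N m a x z = 0 := by
        apply fejerWeight_eq_zero
        rw [Finset.mem_Icc] at hz
        rw [le_abs]; omega
      rw [this, zero_mul]
  refine (Finset.sum_le_sum fun z _ => h1 z).trans ?_
  rw [sum_fin_eq_sum_Icc N fun z : ℤ =>
    if z ∈ Finset.Icc (((x : ℕ) : ℤ) - m) (((x : ℕ) : ℤ) + m) then C * M else 0, ← Finset.sum_filter, Finset.sum_const, nsmul_eq_mul, mul_assoc]
  refine mul_le_mul_of_nonneg_right ?_ (mul_nonneg hC hM)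
  have h4 : (Finset.filter (fun z => z ∈ Finset.Icc (((x : ℕ) : ℤ) - m) (((x : ℕ) : ℤ) + m))
      (Finset.Icc (0 : ℤ) N)).card ≤ 2 * m + 1 := by
    refine (Finset.card_le_card (t := Finset.Icc (((x : ℕ) : ℤ) - m) (((x : ℕ) : ℤ) + m))
      fun z hz => (Finset.mem_filter.1 hz).2).trans ?_
    rw [Int.card_Icc]
    omega
  exact_mod_cast h4

end Fejer

/-! ### Sign structure, comparison and Dirichlet form of the generator. -/

section Generator

variable {N m : ℕ} {c C : ℝ} {a : ℕ → ℝ}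

theorem fejerMatrix_mul_pathLap_apply (d : ℝ) (x y : Fin (N + 1)) :
    (fejerMatrix N m a * pathLap N d) x y = (fejerMatrix N m a * pathLap N 0) x y
      + d * fejerMatrix N m a x y * ((if y = 0 then 1 else 0) + (if y = Fin.last N then 1 else 0))
      := by
  have h1 : ∀ z, pathLap N d z y = pathLap N 0 z y
      + (if z = y then d * ((if y = 0 then 1 else 0) + (if y = Fin.last N then 1 else 0)) else 0)
      := by
    intro z
    simp only [pathLap]
    by_cases h : z = y
    · subst h; simp only [if_true]; split_ifs <;> ring
    · simp [h]
  simp only [Matrix.mul_apply, h1, mul_add, Finset.sum_add_distrib, mul_ite, mul_zero,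
    Finset.sum_ite_eq', Finset.mem_univ, if_true]
  split_ifs <;> ring

theorem EllipticRates.neumann_offDiag_nonneg (h : EllipticRates m c C a) {x y : Fin (N + 1)}
    (hxy : x ≠ y) : 0 ≤ (fejerMatrix N m a * pathLap N 0) x y := by
  have h1 := fejerMatrix_mul_pathLap_mulVec N m a (fun z => if z = y then 1 else 0) x
  simp only [mul_ite, mul_one, mul_zero, Finset.sum_ite_eq', Finset.mem_univ, if_true] at h1
  rw [h1]
  refine mul_nonneg (by norm_num) (Finset.sum_nonneg fun k hk => mul_nonneg (h.nonneg k hk) ?_)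
  simp only [latLap, clampFin_coe, if_neg hxy, mul_zero, sub_zero]
  refine add_nonneg ?_ ?_ <;> split_ifs <;> norm_num

theorem EllipticRates.generator_offDiag_nonneg (h : EllipticRates m c C a) {d : ℝ} (hd : 0 ≤ d)
    {x y : Fin (N + 1)} (hxy : x ≠ y) : 0 ≤ (fejerMatrix N m a * pathLap N d) x y := by
  rw [fejerMatrix_mul_pathLap_apply]
  refine add_nonneg (h.neumann_offDiag_nonneg hxy)
    (mul_nonneg (mul_nonneg hd (h.fejerMatrix_nonneg x y)) ?_)
  refine add_nonneg ?_ ?_ <;> split_ifs <;> norm_num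

theorem EllipticRates.robinMatrix_offDiag_nonneg (h : EllipticRates m c C a) (Am Ap : ℝ)
    {x y : Fin (N + 1)} (hxy : x ≠ y) : 0 ≤ robinMatrix N m a Am Ap x y := by
  simp only [robinMatrix, if_neg hxy, add_zero]
  exact mul_nonneg (sq_nonneg _) (h.neumann_offDiag_nonneg hxy)

/-- The potential is placed inside the second factor, not added to the product, so that
`fejerMatrix` still symmetrises the dominating generator. At an end point the diagonal entry of
`fejerMatrix`, at least c/2, beats the Robin term; the other entries so created are nonnegative and
do no harm to an upper bound. -/
theorem EllipticRates.robinMatrix_le (hm : 1 ≤ m) (hN : 1 ≤ N) (h : EllipticRates m c C a)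
    {Am Ap β : ℝ} (hβ : 0 ≤ β) (hAm : |Am| ≤ β * (c / 2)) (hAp : |Ap| ≤ β * (c / 2))
    (x y : Fin (N + 1)) :
    robinMatrix N m a Am Ap x y
      ≤ (N : ℝ) ^ 2 * (fejerMatrix N m a * pathLap N (β / N)) x y := by
  have hN0 : (0 : ℝ) < N := by exact_mod_cast hN
  rw [fejerMatrix_mul_pathLap_apply, mul_add]
  refine add_le_add le_rfl ?_
  have hrw : (N : ℝ) ^ 2 * (β / N * fejerMatrix N m a x y
      * ((if y = 0 then 1 else 0) + (if y = Fin.last N then 1 else 0)))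
      = N * (β * fejerMatrix N m a x y)
        * ((if y = 0 then 1 else 0) + (if y = Fin.last N then 1 else 0)) := by
    field_simp
  rw [hrw]
  by_cases hxy : x = y
  · subst hxy
    rw [if_pos rfl]
    have h1 : β * (c / 2) ≤ β * fejerMatrix N m a x x :=
      mul_le_mul_of_nonneg_left (h.le_fejerMatrix_self hm x) hβ
    have h2 := neg_abs_le Am
    have h3 := neg_abs_le Ap
    have h4 : -(N * Am) ≤ N * (β * fejerMatrix N m a x x) := by nlinarith
    have h5 : -(N * Ap) ≤ N * (β * fejerMatrix N m a x x) := by nlinarith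
    rw [mul_add]
    refine add_le_add ?_ ?_
    · split_ifs
      · rw [mul_one]; exact h4
      · simp
    · split_ifs
      · rw [mul_one]; exact h5
      · simp
  · rw [if_neg hxy]
    refine mul_nonneg (mul_nonneg hN0.le (mul_nonneg hβ (h.fejerMatrix_nonneg x y))) ?_
    refine add_nonneg ?_ ?_ <;> split_ifs <;> norm_num

/-- Both sides are W Δ_d W, by symmetry of the two factors. -/
theorem generator_mul_fejerMatrix (d : ℝ) :
    (fejerMatrix N m a * pathLap N d) * fejerMatrix N m a
      = fejerMatrix N m a * (fejerMatrix N m a * pathLap N d)ᵀ := by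
  have h1 : (fejerMatrix N m a)ᵀ = fejerMatrix N m a := by
    ext x y; exact fejerMatrix_symm N m a y x
  have h2 : (pathLap N d)ᵀ = pathLap N d := by
    ext x y; exact pathLap_symm N d y x
  rw [Matrix.transpose_mul, h1, h2, Matrix.mul_assoc]

theorem sum_mul_second_difference (F : ℕ → ℝ) (n : ℕ) :
    F 0 * (F 1 - F 0) + ∑ i ∈ Finset.range n, F (i + 1) * (F (i + 2) + F i - 2 * F (i + 1))
      = F n * (F (n + 1) - F n) - ∑ i ∈ Finset.range n, (F (i + 1) - F i) ^ 2 := by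
  induction n with
  | zero => simp
  | succ n ih => rw [Finset.sum_range_succ, Finset.sum_range_succ, ← add_assoc, ih]; ring

/-- Summation by parts; the boundary terms vanish because the clamped extension is flat at both
ends. -/
theorem sum_mul_pathLap_mulVec (d : ℝ) (f : Fin (N + 1) → ℝ) :
    ∑ x, f x * ∑ y, pathLap N d x y * f y
      = -∑ i ∈ Finset.range N, (f (clampFin N ((i : ℤ) + 1)) - f (clampFin N i)) ^ 2
        + d * (f 0 ^ 2 + f (Fin.last N) ^ 2) := by
  simp only [pathLap_mulVec, mul_add, mul_ite, mul_zero, Finset.sum_add_distrib,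
    Finset.sum_ite_eq', Finset.mem_univ, if_true]
  have h1 : ∑ x : Fin (N + 1), f x * latLap 1 (fun z => f (clampFin N z)) ((x : ℕ) : ℤ)
      = ∑ i ∈ Finset.range (N + 1), f (clampFin N i) * latLap 1 (fun z => f (clampFin N z)) i := by
    rw [Finset.sum_range fun i : ℕ =>
      f (clampFin N i) * latLap 1 (fun z => f (clampFin N z)) (i : ℤ)]
    exact Finset.sum_congr rfl fun x _ => by rw [clampFin_coe]
  have h2 := sum_mul_second_difference (fun i : ℕ => f (clampFin N i)) N
  have h3 : f (clampFin N ((N + 1 : ℕ) : ℤ)) = f (clampFin N (N : ℤ)) := by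
    rw [clampFin_of_le (by push_cast; omega), clampFin_of_le le_rfl]
  have h4 : f (clampFin N ((0 : ℤ) - 1)) = f (clampFin N (0 : ℤ)) := by
    rw [clampFin_of_nonpos (by omega), clampFin_of_nonpos le_rfl]
  simp only [h3, sub_self, mul_zero, zero_sub] at h2
  rw [h1, Finset.sum_range_succ']
  have h5 : ∀ i : ℕ, f (clampFin N ((i + 1 : ℕ) : ℤ))
        * latLap 1 (fun z => f (clampFin N z)) ((i + 1 : ℕ) : ℤ)
      = f (clampFin N ((i + 1 : ℕ) : ℤ)) * (f (clampFin N ((i + 2 : ℕ) : ℤ))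
        + f (clampFin N (i : ℤ)) - 2 * f (clampFin N ((i + 1 : ℕ) : ℤ))) := by
    intro i
    simp only [latLap]
    push_cast
    rw [show (i : ℤ) + 1 + 1 = i + 2 by ring, show (i : ℤ) + 1 - 1 = i by ring]
  have h6 : f (clampFin N ((0 : ℕ) : ℤ)) * latLap 1 (fun z => f (clampFin N z)) ((0 : ℕ) : ℤ)
      = f (clampFin N ((0 : ℕ) : ℤ))
        * (f (clampFin N ((1 : ℕ) : ℤ)) - f (clampFin N ((0 : ℕ) : ℤ))) := by
    simp only [latLap, Nat.cast_zero, h4, Nat.cast_one, zero_add]; ring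
  rw [Finset.sum_congr rfl fun i _ => h5 i, h6, add_comm (∑ i ∈ Finset.range N, _), h2]
  push_cast
  ring

end Generator

/-! ### A supersolution for the generator with boundary potential. -/

section Weight

/-- A function comparable to `exp (θ |y - x|)` whose slopes at the end points of `⟦0, N⟧` absorb a
boundary potential. -/
def robinWeight (N : ℕ) (θ x y : ℝ) : ℝ :=
  Real.cosh (θ * (y - x)) + Real.exp (-(θ * y)) + Real.exp (-(θ * (N - y)))

variable {N : ℕ} {θ x y : ℝ}

theorem robinWeight_pos : 0 < robinWeight N θ x y := by
  unfold robinWeight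
  have := Real.cosh_pos (θ * (y - x))
  positivity

/-- All three summands are combinations of exp(θy) and exp(-θy), hence eigenfunctions of the
discrete second difference with one eigenvalue. -/
theorem robinWeight_second_difference :
    robinWeight N θ x (y + 1) + robinWeight N θ x (y - 1) - 2 * robinWeight N θ x y
      = 2 * (Real.cosh θ - 1) * robinWeight N θ x y := by
  unfold robinWeight
  have h1 : θ * (y + 1 - x) = θ * (y - x) + θ := by ring
  have h2 : θ * (y - 1 - x) = θ * (y - x) - θ := by ring
  have h3 : -(θ * (y + 1)) = -(θ * y) + -θ := by ring
  have h4 : -(θ * (y - 1)) = -(θ * y) + θ := by ring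
  have h5 : -(θ * (N - (y + 1))) = -(θ * (N - y)) + θ := by ring
  have h6 : -(θ * (N - (y - 1))) = -(θ * (N - y)) + -θ := by ring
  rw [h1, h2, h3, h4, h5, h6, Real.cosh_add, Real.cosh_sub, Real.exp_add, Real.exp_add,
    Real.exp_add, Real.exp_add, Real.cosh_eq θ]
  ring

theorem robinWeight_reflect : robinWeight N θ (N - x) (N - y) = robinWeight N θ x y := by
  unfold robinWeight
  rw [show θ * ((N : ℝ) - y - (N - x)) = -(θ * (y - x)) by ring, Real.cosh_neg, sub_sub_cancel]
  ring

/-- The cosh term grows outwards by at least θ sinh(θx), which degenerates for `x` near 0; there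
exp(-θy) supplies growth at least θ. The far exponential loses at most θ/2, because exp(-θN) ≤ 1/2.
-/
theorem robinWeight_boundary {d : ℝ} (hx : 0 ≤ x) (hθ : 0 ≤ θ) (hd : 6 * d ≤ θ)
    (hN : 1 ≤ θ * N) :
    (1 + d) * robinWeight N θ x 0 ≤ robinWeight N θ x (-1) := by
  unfold robinWeight
  set u := θ * x with hu
  have hu0 : 0 ≤ u := mul_nonneg hθ hx
  have h1 : θ * (0 - x) = -u := by rw [hu]; ring
  have h2 : θ * (-1 - x) = -(u + θ) := by rw [hu]; ring
  have h3 : -(θ * ((N : ℝ) - 0)) = -(θ * N) := by ring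
  have h4 : -(θ * ((N : ℝ) - -1)) = -(θ * N) + -θ := by ring
  have h5 : -(θ * (-1 : ℝ)) = θ := by ring
  rw [h1, h2, h3, h4, h5, Real.cosh_neg, Real.cosh_neg, Real.cosh_add, mul_zero, neg_zero,
    Real.exp_zero, Real.exp_add]
  have hs0 : 0 ≤ Real.sinh u := Real.sinh_nonneg_iff.2 hu0
  have hs1 : θ ≤ Real.sinh θ := Real.self_le_sinh_iff.2 hθ
  have hc1 : 1 ≤ Real.cosh θ := Real.one_le_cosh θ
  have hc0 := Real.cosh_pos u
  have he1 := Real.add_one_le_exp θ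
  have he2 := Real.add_one_le_exp (-θ)
  have hcs : Real.cosh u ≤ Real.sinh u + 1 := by
    have h6 : Real.exp (-u) ≤ 1 := Real.exp_le_one_iff.2 (by linarith)
    rw [← Real.cosh_sub_sinh] at h6
    linarith
  have hp := Real.exp_pos (-(θ * N))
  have hp2 : Real.exp (-(θ * N)) ≤ 1 / 2 := by
    rw [Real.exp_neg, one_div]
    exact inv_anti₀ (by norm_num) (by linarith [Real.add_one_le_exp (θ * N)])
  have k1 : Real.cosh u + θ * Real.sinh u ≤ Real.cosh u * Real.cosh θ + Real.sinh u * Real.sinh θ :=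
    by nlinarith
  have k2 : Real.exp (-(θ * N)) - θ / 2 ≤ Real.exp (-(θ * N)) * Real.exp (-θ) := by nlinarith
  -- The total weight is at most sinh u + 3, so the factor 6 in `hd` is what fits 3d under the
  -- remaining θ/2.
  have k3 : d * (Real.cosh u + 1 + Real.exp (-(θ * N))) ≤ θ * (Real.sinh u + 1 / 2) := by
    have k4 : d * (Real.cosh u + 1 + Real.exp (-(θ * N)))
        ≤ (θ / 6) * (Real.cosh u + 1 + Real.exp (-(θ * N))) :=
      mul_le_mul_of_nonneg_right (by linarith) (by positivity)
    have k5 : (θ / 6) * (Real.cosh u + 1 + Real.exp (-(θ * N))) ≤ (θ / 6) * (Real.sinh u + 3) :=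
      mul_le_mul_of_nonneg_left (by linarith) (by positivity)
    have k6 : 0 ≤ θ * Real.sinh u := mul_nonneg hθ hs0
    linarith
  nlinarith

theorem robinWeight_boundary' {d : ℝ} (hx : x ≤ N) (hθ : 0 ≤ θ) (hd : 6 * d ≤ θ)
    (hN : 1 ≤ θ * N) :
    (1 + d) * robinWeight N θ x N ≤ robinWeight N θ x (N + 1) := by
  have h := robinWeight_boundary (x := N - x) (by linarith) hθ hd hN
  rw [← robinWeight_reflect (x := x) (y := N), ← robinWeight_reflect (x := x) (y := N + 1),
    sub_self, show (N : ℝ) - (N + 1) = -1 by ring]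
  exact h

theorem cosh_add_le (u v : ℝ) : Real.cosh (u + v) ≤ Real.exp |v| * Real.cosh u := by
  rw [Real.cosh_eq, Real.cosh_eq, neg_add, Real.exp_add, Real.exp_add]
  have h1 : Real.exp v ≤ Real.exp |v| := Real.exp_le_exp.2 (le_abs_self v)
  have h2 : Real.exp (-v) ≤ Real.exp |v| := Real.exp_le_exp.2 (neg_le_abs v)
  have := Real.exp_pos u
  have := Real.exp_pos (-u)
  nlinarith

/-- The weight changes by a bounded factor over the bandwidth of `fejerMatrix`, so averaging against
a row of that matrix costs only a constant. -/
theorem robinWeight_le_mul {z r : ℝ} (hθ : 0 ≤ θ) (hz : |y - z| ≤ r) :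
    robinWeight N θ x z ≤ Real.exp (θ * r) * robinWeight N θ x y := by
  unfold robinWeight
  rw [mul_add, mul_add]
  have hv : |θ * (z - y)| ≤ θ * r := by
    rw [abs_mul, abs_of_nonneg hθ, abs_sub_comm]
    exact mul_le_mul_of_nonneg_left hz hθ
  obtain ⟨hv1, hv2⟩ := abs_le.1 hv
  refine add_le_add (add_le_add ?_ ?_) ?_
  · rw [show θ * (z - x) = θ * (y - x) + θ * (z - y) by ring]
    exact (cosh_add_le _ _).trans
      (mul_le_mul_of_nonneg_right (Real.exp_le_exp.2 hv) (Real.cosh_pos _).le)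
  · rw [← Real.exp_add]
    exact Real.exp_le_exp.2 (by linarith)
  · rw [← Real.exp_add]
    exact Real.exp_le_exp.2 (by linarith)

theorem exp_mul_abs_le_robinWeight : Real.exp (θ * |x - y|) ≤ 2 * robinWeight N θ x y := by
  unfold robinWeight
  have h1 := Real.exp_pos (-(θ * y))
  have h2 := Real.exp_pos (-(θ * (N - y)))
  have h3 : Real.exp (θ * |x - y|) ≤ 2 * Real.cosh (θ * (y - x)) := by
    rw [Real.cosh_eq]
    have h4 := Real.exp_pos (θ * (y - x))
    have h5 := Real.exp_pos (-(θ * (y - x)))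
    rcases abs_cases (x - y) with h | h
    · rw [h.1, show θ * (x - y) = -(θ * (y - x)) by ring]; linarith
    · rw [h.1, show θ * -(x - y) = θ * (y - x) by ring]; linarith
  linarith

theorem robinWeight_self_le (hθ : 0 ≤ θ) (hx0 : 0 ≤ x) (hxN : x ≤ N) :
    robinWeight N θ x x ≤ 3 := by
  unfold robinWeight
  rw [sub_self, mul_zero, Real.cosh_zero]
  have h1 : Real.exp (-(θ * x)) ≤ 1 := Real.exp_le_one_iff.2 (by nlinarith)
  have h2 : Real.exp (-(θ * (N - x))) ≤ 1 := Real.exp_le_one_iff.2 (by nlinarith)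
  linarith

/-- With v = θ²/2, cosh θ - 1 ≤ e^v - 1 ≤ v e^v. Quadratic smallness in θ keeps the growth rate
times `t` bounded when θ is of order t^(-1/2). -/
theorem two_mul_cosh_sub_one_le (θ : ℝ) :
    2 * (Real.cosh θ - 1) ≤ θ ^ 2 * Real.exp (θ ^ 2 / 2) := by
  have h1 := Real.cosh_le_exp_half_sq θ
  have h2 := Real.add_one_le_exp (-(θ ^ 2 / 2))
  have h3 : Real.exp (-(θ ^ 2 / 2)) * Real.exp (θ ^ 2 / 2) = 1 := by
    rw [← Real.exp_add]; simp
  have h4 := Real.exp_pos (θ ^ 2 / 2)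
  nlinarith

end Weight

/-! ### Exponential moments of the rows. -/

section RowSums

variable {N m : ℕ} {c C : ℝ} {a : ℕ → ℝ}

/-- At an end point the reflected value plus the potential term is at most the value of the weight
one site outside, so the interior eigenvalue identity becomes an inequality up to the boundary. -/
theorem pathLap_mulVec_robinWeight_le {d θ : ℝ} (hθ : 0 ≤ θ) (hd : 6 * d ≤ θ)
    (hN : 1 ≤ θ * N) (x y : Fin (N + 1)) :
    ∑ z, pathLap N d y z * robinWeight N θ (x : ℕ) (z : ℕ)
      ≤ 2 * (Real.cosh θ - 1) * robinWeight N θ (x : ℕ) (y : ℕ) := by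
  have hxN : ((x : ℕ) : ℝ) ≤ N := by exact_mod_cast Nat.lt_succ_iff.1 x.2
  rw [pathLap_mulVec N d (fun z => robinWeight N θ (x : ℕ) (z : ℕ)) y,
    ← robinWeight_second_difference]
  simp only [latLap, clampFin_coe]
  have hy := y.2
  have hlow : robinWeight N θ (x : ℕ) (clampFin N (((y : ℕ) : ℤ) - 1) : ℕ)
      + (if y = 0 then d * robinWeight N θ (x : ℕ) (y : ℕ) else 0)
      ≤ robinWeight N θ (x : ℕ) (((y : ℕ) : ℝ) - 1) := by
    by_cases h : y = 0
    · subst h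
      rw [if_pos rfl, clampFin_of_nonpos (by simp)]
      have := robinWeight_boundary (x := ((x : ℕ) : ℝ)) (by positivity) hθ hd hN
      simp only [Fin.val_zero, Nat.cast_zero, zero_sub]
      linarith
    · have h0 : (y : ℕ) ≠ 0 := fun h' => h (Fin.ext h')
      have h1 : ((clampFin N (((y : ℕ) : ℤ) - 1) : Fin (N + 1)) : ℕ) + 1 = (y : ℕ) := by
        simp only [clampFin]; omega
      have h2 : (((clampFin N (((y : ℕ) : ℤ) - 1) : Fin (N + 1)) : ℕ) : ℝ) + 1 = (y : ℕ) := by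
        exact_mod_cast h1
      rw [if_neg h, add_zero, eq_sub_of_add_eq h2]
  have hhigh : robinWeight N θ (x : ℕ) (clampFin N (((y : ℕ) : ℤ) + 1) : ℕ)
      + (if y = Fin.last N then d * robinWeight N θ (x : ℕ) (y : ℕ) else 0)
      ≤ robinWeight N θ (x : ℕ) (((y : ℕ) : ℝ) + 1) := by
    by_cases h : y = Fin.last N
    · subst h
      rw [if_pos rfl, clampFin_of_le (by simp)]
      have := robinWeight_boundary' (x := ((x : ℕ) : ℝ)) hxN hθ hd hN
      simp only [Fin.val_last]
      linarith
    · have h0 : (y : ℕ) ≠ N := fun h' => h (Fin.ext h')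
      have h1 : ((clampFin N (((y : ℕ) : ℤ) + 1) : Fin (N + 1)) : ℕ) = (y : ℕ) + 1 := by
        simp only [clampFin]; omega
      rw [if_neg h, add_zero, h1]
      push_cast
      exact le_rfl
  linarith

theorem EllipticRates.generator_mulVec_robinWeight_le (h : EllipticRates m c C a) {d θ : ℝ}
    (hθ : 0 ≤ θ) (hd : 6 * d ≤ θ) (hN : 1 ≤ θ * N) (x y : Fin (N + 1)) :
    ∑ z, (fejerMatrix N m a * pathLap N d) y z * robinWeight N θ (x : ℕ) (z : ℕ)
      ≤ (θ ^ 2 * Real.exp (θ ^ 2 / 2) * ((2 * m + 1) * C * Real.exp (θ * m)))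
        * robinWeight N θ (x : ℕ) (y : ℕ) := by
  have hC := h.moment_nonneg
  have h1 : ∑ z, (fejerMatrix N m a * pathLap N d) y z * robinWeight N θ (x : ℕ) (z : ℕ)
      = ∑ u, fejerMatrix N m a y u * ∑ z, pathLap N d u z * robinWeight N θ (x : ℕ) (z : ℕ) := by
    simp only [Matrix.mul_apply, Finset.sum_mul, Finset.mul_sum]
    rw [Finset.sum_comm]
    exact Finset.sum_congr rfl fun _ _ => Finset.sum_congr rfl fun _ _ => by ring
  rw [h1]
  calc _ ≤ ∑ u, fejerMatrix N m a y u
          * (2 * (Real.cosh θ - 1) * robinWeight N θ (x : ℕ) (u : ℕ)) :=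
        Finset.sum_le_sum fun u _ => mul_le_mul_of_nonneg_left
          (pathLap_mulVec_robinWeight_le hθ hd hN x u) (h.fejerMatrix_nonneg y u)
    _ = 2 * (Real.cosh θ - 1) * ∑ u, fejerMatrix N m a y u * robinWeight N θ (x : ℕ) (u : ℕ) := by
        rw [Finset.mul_sum]; exact Finset.sum_congr rfl fun _ _ => by ring
    _ ≤ θ ^ 2 * Real.exp (θ ^ 2 / 2) * ((2 * m + 1) * C
          * (Real.exp (θ * m) * robinWeight N θ (x : ℕ) (y : ℕ))) := by
        refine mul_le_mul (two_mul_cosh_sub_one_le θ) ?_ ?_ (by positivity)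
        · exact h.sum_fejerMatrix_mul_le y
            (mul_nonneg (Real.exp_pos _).le robinWeight_pos.le)
            fun z hz => robinWeight_le_mul hθ hz
        · exact Finset.sum_nonneg fun u _ =>
            mul_nonneg (h.fejerMatrix_nonneg y u) robinWeight_pos.le
    _ = _ := by ring

theorem EllipticRates.exp_generator_nonneg (h : EllipticRates m c C a) {d : ℝ} (hd : 0 ≤ d)
    {t : ℝ} (ht : 0 ≤ t) (x y : Fin (N + 1)) :
    0 ≤ NormedSpace.exp (t • (fejerMatrix N m a * pathLap N d)) x y := by
  refine (Matrix.exp_apply_nonneg_le (fun u v huv => ?_) (fun _ _ => le_rfl) x y).1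
  exact mul_nonneg ht (h.generator_offDiag_nonneg hd huv)

/-- Exponential moments of the rows of the heat kernel. -/
theorem EllipticRates.sum_exp_generator_mul_exp_le (h : EllipticRates m c C a) {d θ κ : ℝ}
    (hd0 : 0 ≤ d) (hd : 6 * d ≤ θ) (hN : 1 ≤ θ * N) (hθκ : θ ≤ κ) {t : ℝ} (ht : 0 ≤ t)
    (x : Fin (N + 1)) :
    ∑ y, NormedSpace.exp (t • (fejerMatrix N m a * pathLap N d)) x y
        * Real.exp (θ * |((x : ℕ) : ℝ) - ((y : ℕ) : ℝ)|)
      ≤ 6 * Real.exp (Real.exp (κ ^ 2 / 2) * ((2 * m + 1) * C * Real.exp (κ * m))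
          * (θ ^ 2 * t)) := by
  have hθ : 0 ≤ θ := by linarith
  have hC := h.moment_nonneg
  have hxN : ((x : ℕ) : ℝ) ≤ N := by exact_mod_cast Nat.lt_succ_iff.1 x.2
  have h1 := Matrix.sum_exp_smul_mul_le
    (fun u v huv => h.generator_offDiag_nonneg (N := N) hd0 huv)
    (fun y => h.generator_mulVec_robinWeight_le hθ hd hN x y) ht x
  have h2 : ∑ y, NormedSpace.exp (t • (fejerMatrix N m a * pathLap N d)) x y
        * Real.exp (θ * |((x : ℕ) : ℝ) - ((y : ℕ) : ℝ)|)
      ≤ 2 * ∑ y, NormedSpace.exp (t • (fejerMatrix N m a * pathLap N d)) x y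
        * robinWeight N θ (x : ℕ) (y : ℕ) := by
    rw [Finset.mul_sum]
    refine Finset.sum_le_sum fun y _ => ?_
    rw [mul_left_comm]
    exact mul_le_mul_of_nonneg_left exp_mul_abs_le_robinWeight (h.exp_generator_nonneg hd0 ht x y)
  have h3 := robinWeight_self_le (N := N) hθ (x := ((x : ℕ) : ℝ)) (by positivity) hxN
  have h4 : Real.exp (θ ^ 2 * Real.exp (θ ^ 2 / 2) * ((2 * m + 1) * C * Real.exp (θ * m)) * t)
      ≤ Real.exp (Real.exp (κ ^ 2 / 2) * ((2 * m + 1) * C * Real.exp (κ * m)) * (θ ^ 2 * t)) := by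
    rw [Real.exp_le_exp]
    have h5 : Real.exp (θ ^ 2 / 2) ≤ Real.exp (κ ^ 2 / 2) := Real.exp_le_exp.2 (by gcongr)
    have h6 : Real.exp (θ * m) ≤ Real.exp (κ * m) := Real.exp_le_exp.2 (by gcongr)
    calc _ = Real.exp (θ ^ 2 / 2) * ((2 * m + 1) * C * Real.exp (θ * m)) * (θ ^ 2 * t) := by ring
      _ ≤ _ := by gcongr
  have h7 := Real.exp_pos (θ ^ 2 * Real.exp (θ ^ 2 / 2) * ((2 * m + 1) * C * Real.exp (θ * m)) * t)
  nlinarith [robinWeight_pos (N := N) (θ := θ) (x := ((x : ℕ) : ℝ)) (y := ((x : ℕ) : ℝ))]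

end RowSums

/-! ### Nash inequality and the associated differential inequality. -/

section Nash

/-- If `E' ≤ -c E³` as long as `E > e`, then `E t ≤ e + (2 c t)^{-1/2}`. -/
theorem le_add_inv_sqrt_of_deriv_le_neg_cube {E E' : ℝ → ℝ} {T e c : ℝ} (he : 0 < e) (hc : 0 < c)
    (hE : ∀ t, HasDerivAt E (E' t) t)
    (hE' : ∀ t, 0 ≤ t → t ≤ T → e < E t → E' t ≤ -c * E t ^ 3) {t : ℝ} (ht : 0 < t)
    (htT : t ≤ T) : E t ≤ e + 1 / Real.sqrt (2 * c * t) := by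
  -- The barrier is `e` plus the solution (p⁻² + 2cs)^(-1/2) of y' = -c y³, started at `p`, so that
  -- it lies above `E` at time 0.
  set p : ℝ := 1 + |E 0| with hp
  have hp0 : 0 < p := by positivity
  let q : ℝ → ℝ := fun s => (p ^ 2)⁻¹ + 2 * c * s
  have hq : ∀ s, 0 ≤ s → 0 < q s := fun s hs => by
    have : 0 ≤ 2 * c * s := by positivity
    have : 0 < (p ^ 2)⁻¹ := by positivity
    simp only [q]; linarith
  have hB : ∀ s, 0 ≤ s → HasDerivAt (fun s => e + (Real.sqrt (q s))⁻¹)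
      (-c * (Real.sqrt (q s))⁻¹ ^ 3) s := by
    intro s hs
    have hqs := hq s hs
    have h1 : HasDerivAt q (2 * c) s := by
      have h0 := ((hasDerivAt_id s).const_mul (2 * c)).const_add ((p ^ 2)⁻¹)
      rw [mul_one] at h0
      exact h0
    have h2 := ((h1.sqrt hqs.ne').fun_inv (Real.sqrt_pos.2 hqs).ne').const_add e
    refine h2.congr_deriv ?_
    have h3 := Real.sqrt_pos.2 hqs
    field_simp
  have key := image_le_of_deriv_right_lt_deriv_boundary' (f := E) (f' := E') (a := 0) (b := t)
    (fun s _ => (hE s).continuousAt.continuousWithinAt)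
    (fun s _ => (hE s).hasDerivWithinAt)
    (B := fun s => e + (Real.sqrt (q s))⁻¹) (B' := fun s => -c * (Real.sqrt (q s))⁻¹ ^ 3)
    (by
      have h1 : Real.sqrt (q 0) = p⁻¹ := by
        simp only [q, mul_zero, add_zero, ← inv_pow]
        exact Real.sqrt_sq (by positivity)
      simp only [h1, inv_inv]
      have := le_abs_self (E 0)
      rw [hp]; linarith)
    (fun s hs => (hB s hs.1).continuousAt.continuousWithinAt)
    (fun s hs => (hB s hs.1).hasDerivWithinAt)
    (by
      intro s hs hEB
      have hu : 0 < (Real.sqrt (q s))⁻¹ := inv_pos.2 (Real.sqrt_pos.2 (hq s hs.1))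
      have h1 : e < E s := by rw [hEB]; linarith
      have h2 := hE' s hs.1 (hs.2.le.trans htT) h1
      -- Since e > 0, at a contact point `E` exceeds the solution y itself, which makes the
      -- comparison of derivatives strict.
      have h3 : (Real.sqrt (q s))⁻¹ ^ 3 < E s ^ 3 :=
        pow_lt_pow_left₀ (by rw [hEB]; linarith) hu.le (by norm_num)
      nlinarith)
    (Set.right_mem_Icc.2 ht.le)
  refine key.trans (add_le_add le_rfl ?_)
  rw [← one_div]
  refine one_div_le_one_div_of_le (Real.sqrt_pos.2 (by positivity)) (Real.sqrt_le_sqrt ?_)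
  have : 0 < (p ^ 2)⁻¹ := by positivity
  simp only [q]; linarith

variable {N : ℕ}

/-- A Nash inequality on `⟦0, N⟧`, in terms of the maximum of `f`. -/
theorem cube_le_mul_sum_sq_sub (hN : 1 ≤ N) {f : Fin (N + 1) → ℝ} (hf : ∀ x, 0 ≤ f x) {K : ℝ}
    (hK : ∑ x, f x ≤ K) {x₀ : Fin (N + 1)} (hmax : ∀ x, f x ≤ f x₀) (hbig : 2 * K / N ≤ f x₀) :
    f x₀ ^ 3 ≤ 16 * K
      * ∑ i ∈ Finset.range N, (f (clampFin N ((i : ℤ) + 1)) - f (clampFin N i)) ^ 2 := by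
  have hN0 : (0 : ℝ) < N := by exact_mod_cast hN
  set F := f x₀ with hF
  set h : ℕ → ℝ := fun i => f (clampFin N (i : ℤ)) with hh
  have hh1 : ∀ i : ℕ, f (clampFin N ((i : ℤ) + 1)) = h (i + 1) := fun i => by
    simp only [hh]; push_cast; rfl
  have hh0 : ∀ x : Fin (N + 1), f x = h x := fun x => by simp only [hh, clampFin_coe]
  have hF0 : 0 ≤ F := hf x₀
  have hK0 : 0 ≤ K := (Finset.sum_nonneg fun x _ => hf x).trans hK
  simp only [hh1]
  set G := ∑ i ∈ Finset.range N, (h (i + 1) - h i) ^ 2 with hG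
  have hG0 : 0 ≤ G := Finset.sum_nonneg fun _ _ => sq_nonneg _
  -- Otherwise the total mass exceeds (N + 1)F/2, hence `K` by `hbig`. Between `x₀` and `z` the
  -- square of `f` drops by at least 3F²/4.
  obtain ⟨z, hz⟩ : ∃ z, f z ≤ F / 2 := by
    by_contra! hcon
    have h1 : ∑ _x : Fin (N + 1), F / 2 < ∑ x, f x :=
      Finset.sum_lt_sum_of_nonempty Finset.univ_nonempty fun x _ => hcon x
    rw [Finset.sum_const, Finset.card_univ, Fintype.card_fin, nsmul_eq_mul] at h1
    push_cast at h1
    rw [div_le_iff₀ hN0] at hbig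
    nlinarith
  have hsumh : ∑ i ∈ Finset.range (N + 1), h i ≤ K := by
    rw [Finset.sum_range]
    simpa only [← hh0] using hK
  have hhF : ∀ i, h i ≤ F := fun i => hmax _
  have hhn : ∀ i, 0 ≤ h i := fun i => hf _
  -- total variation of the square
  have hV : F ^ 2 - f z ^ 2 ≤ ∑ i ∈ Finset.range N, |h (i + 1) - h i| * (h (i + 1) + h i) := by
    have hterm : ∀ i, dist (h i ^ 2) (h (i + 1) ^ 2) = |h (i + 1) - h i| * (h (i + 1) + h i) := by
      intro i
      rw [dist_comm, Real.dist_eq, sq_sub_sq, abs_mul,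
        abs_of_nonneg (add_nonneg (hhn (i + 1)) (hhn i)), mul_comm]
    have hgen : ∀ i j : ℕ, i ≤ j → j ≤ N → dist (h i ^ 2) (h j ^ 2)
        ≤ ∑ i ∈ Finset.range N, |h (i + 1) - h i| * (h (i + 1) + h i) := by
      intro i j hij hj
      refine (dist_le_Ico_sum_dist (fun i => h i ^ 2) hij).trans ?_
      simp only [hterm]
      refine Finset.sum_le_sum_of_subset_of_nonneg (fun k hk => ?_) fun k _ _ =>
        mul_nonneg (abs_nonneg _) (add_nonneg (hhn _) (hhn _))
      rw [Finset.mem_Ico] at hk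
      exact Finset.mem_range.2 (hk.2.trans_le hj)
    rw [hF, hh0 x₀, hh0 z]
    refine (le_abs_self _).trans ?_
    rw [← Real.dist_eq]
    rcases le_total (x₀ : ℕ) (z : ℕ) with hxz | hxz
    · exact hgen _ _ hxz (Nat.lt_succ_iff.1 z.2)
    · rw [dist_comm]
      exact hgen _ _ hxz (Nat.lt_succ_iff.1 x₀.2)
  have hCS := Finset.sum_mul_sq_le_sq_mul_sq (Finset.range N) (fun i => |h (i + 1) - h i|)
    (fun i => h (i + 1) + h i)
  simp only [sq_abs] at hCS
  rw [← hG] at hCS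
  have hS : ∑ i ∈ Finset.range N, (h (i + 1) + h i) ^ 2 ≤ 4 * F * K := by
    have h1 : ∀ i ∈ Finset.range N, (h (i + 1) + h i) ^ 2 ≤ 2 * F * h (i + 1) + 2 * F * h i := by
      intro i _
      nlinarith [hhF (i + 1), hhF i, hhn (i + 1), hhn i]
    refine (Finset.sum_le_sum h1).trans ?_
    rw [Finset.sum_add_distrib, ← Finset.mul_sum, ← Finset.mul_sum]
    have h2 : ∑ i ∈ Finset.range N, h (i + 1) ≤ K := by
      rw [Finset.sum_range_succ'] at hsumh
      linarith [hhn 0]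
    have h3 : ∑ i ∈ Finset.range N, h i ≤ K := by
      rw [Finset.sum_range_succ] at hsumh
      linarith [hhn N]
    nlinarith
  have hfz := hf z
  have hquad : 3 / 4 * F ^ 2 ≤ ∑ i ∈ Finset.range N, |h (i + 1) - h i| * (h (i + 1) + h i) := by
    nlinarith
  -- Cauchy–Schwarz gives F³ ≤ (64/9) K G; the constant 16 is this, rounded up.
  have h4 : (3 / 4 * F ^ 2) ^ 2 ≤ G * (4 * F * K) :=
    (pow_le_pow_left₀ (by positivity) hquad 2).trans
      (hCS.trans (mul_le_mul_of_nonneg_left hS hG0))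
  rcases hF0.eq_or_lt with h0 | h0
  · rw [← h0]; have := mul_nonneg hK0 hG0; linarith
  · have h5 : F * (9 / 16 * F ^ 3) ≤ F * (4 * K * G) := by nlinarith
    have h6 := le_of_mul_le_mul_left h5 h0
    have h7 : 0 ≤ K * G := mul_nonneg hK0 hG0
    linarith

end Nash

/-! ### On-diagonal decay of the symmetrised kernel. -/

section OnDiagonal

variable {N m : ℕ} {c C : ℝ} {a : ℕ → ℝ}

theorem exp_generator_mul_fejerMatrix_symm (d t : ℝ) (x y : Fin (N + 1)) :
    (NormedSpace.exp (t • (fejerMatrix N m a * pathLap N d)) * fejerMatrix N m a) x y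
      = (NormedSpace.exp (t • (fejerMatrix N m a * pathLap N d)) * fejerMatrix N m a) y x := by
  have h1 : (fejerMatrix N m a)ᵀ = fejerMatrix N m a := by
    ext x y; exact fejerMatrix_symm N m a y x
  have h2 : NormedSpace.exp (t • (fejerMatrix N m a * pathLap N d)) * fejerMatrix N m a
      = fejerMatrix N m a * NormedSpace.exp ((t • (fejerMatrix N m a * pathLap N d))ᵀ) := by
    refine Matrix.exp_mul_of_mul_eq ?_
    rw [Matrix.transpose_smul, Matrix.smul_mul, generator_mul_fejerMatrix, Matrix.mul_smul]
  have h3 : (NormedSpace.exp (t • (fejerMatrix N m a * pathLap N d)) * fejerMatrix N m a)ᵀ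
      = NormedSpace.exp (t • (fejerMatrix N m a * pathLap N d)) * fejerMatrix N m a := by
    rw [Matrix.transpose_mul, h1, ← Matrix.exp_transpose, h2]
  exact congrFun (congrFun h3 y) x

/-- Semigroup property and symmetry. On the diagonal this is the quantity playing the role of the
squared ℓ² norm in Nash's argument. -/
theorem exp_two_mul_generator_mul_fejerMatrix (d t : ℝ) (x y : Fin (N + 1)) :
    (NormedSpace.exp ((2 * t) • (fejerMatrix N m a * pathLap N d)) * fejerMatrix N m a) x y
      = ∑ z, NormedSpace.exp (t • (fejerMatrix N m a * pathLap N d)) x z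
        * (NormedSpace.exp (t • (fejerMatrix N m a * pathLap N d)) * fejerMatrix N m a) y z := by
  rw [two_mul, Matrix.exp_smul_add, Matrix.mul_assoc, Matrix.mul_apply]
  exact Finset.sum_congr rfl fun z _ => by rw [exp_generator_mul_fejerMatrix_symm d t z y]

theorem hasDerivAt_exp_two_mul_generator (d t : ℝ) (x : Fin (N + 1)) :
    HasDerivAt (fun t : ℝ =>
        (NormedSpace.exp ((2 * t) • (fejerMatrix N m a * pathLap N d)) * fejerMatrix N m a) x x)
      (2 * ∑ u, (NormedSpace.exp (t • (fejerMatrix N m a * pathLap N d)) * fejerMatrix N m a) x u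
        * ∑ v, pathLap N d u v
          * (NormedSpace.exp (t • (fejerMatrix N m a * pathLap N d)) * fejerMatrix N m a) x v) t
    := by
  set A := fejerMatrix N m a * pathLap N d with hA
  set W := fejerMatrix N m a with hW
  have h1 : HasDerivAt (fun s : ℝ => (NormedSpace.exp (s • A) * W) x x)
      ((NormedSpace.exp ((2 * t) • A) * A * W) x x) (2 * t) := by
    simp only [Matrix.mul_apply (M := NormedSpace.exp (_ • A)) (N := W)]
    rw [Matrix.mul_apply (M := NormedSpace.exp ((2 * t) • A) * A)]
    exact HasDerivAt.fun_sum fun z _ => (Matrix.hasDerivAt_exp_smul_apply A (2 * t) x z).mul_const _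
  have h2 : HasDerivAt (fun t : ℝ => 2 * t) 2 t := by
    simpa using (hasDerivAt_id t).const_mul (2 : ℝ)
  have h3 := h1.comp t h2
  refine h3.congr_deriv ?_
  have hcomm : NormedSpace.exp (t • A) * A = A * NormedSpace.exp (t • A) :=
    (Matrix.exp_mul_of_mul_eq (W := A) (A := t • A) (B := t • A)
      (by rw [Matrix.smul_mul, Matrix.mul_smul]))
  have h4 : NormedSpace.exp ((2 * t) • A) * A * W
      = (NormedSpace.exp (t • A) * W) * (pathLap N d * (NormedSpace.exp (t • A) * W)) := by
    rw [two_mul, Matrix.exp_smul_add, Matrix.mul_assoc (NormedSpace.exp (t • A)), hcomm]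
    have h5 : ∀ X, A * X = W * (pathLap N d * X) := fun X => by rw [hA, Matrix.mul_assoc]
    simp only [Matrix.mul_assoc, h5]
  rw [h4, mul_comm, Matrix.mul_apply]
  congr 1
  refine Finset.sum_congr rfl fun u _ => ?_
  rw [Matrix.mul_apply (M := pathLap N d)]
  congr 1
  refine Finset.sum_congr rfl fun v _ => ?_
  rw [hA, hW, exp_generator_mul_fejerMatrix_symm d t v x]

theorem EllipticRates.sum_fejerMatrix_le (h : EllipticRates m c C a) (x : Fin (N + 1)) :
    ∑ z, fejerMatrix N m a x z ≤ (2 * m + 1) * C := by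
  simpa using h.sum_fejerMatrix_mul_le x (φ := fun _ => 1) (M := 1) zero_le_one
    (fun _ _ => le_rfl)

/-- Nash's argument: decay of the diagonal of `exp (t W S) W`. -/
theorem EllipticRates.exp_generator_mul_fejerMatrix_self_le (hm : 1 ≤ m)
    (h : EllipticRates m c C a) (hc : 0 < c) (hN : 1 ≤ N) {β K T : ℝ} (hβ : 0 ≤ β) (hK : 0 < K)
    (hrow : ∀ t, 0 ≤ t → t ≤ T → ∀ x,
      ∑ y, NormedSpace.exp (t • (fejerMatrix N m a * pathLap N (β / N))) x y ≤ K)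
    {t : ℝ} (ht : 0 < t) (htT : t ≤ T) (x : Fin (N + 1)) :
    (NormedSpace.exp ((2 * t) • (fejerMatrix N m a * pathLap N (β / N))) * fejerMatrix N m a) x x
      ≤ K * ((2 + 64 * β) * ((2 * m + 1) * C * K)) / N
        + 1 / Real.sqrt (2 * (1 / (16 * ((2 * m + 1) * C * K) * K ^ 3)) * t) := by
  have hN0 : (0 : ℝ) < N := by exact_mod_cast hN
  have hC0 : 0 < C := by
    have h1 := h.le_fejerWeight_zero hm
    have h2 := h.fejerWeight_le 0
    linarith
  set K' := (2 * m + 1) * C * K with hK'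
  have hK'0 : 0 < K' := by positivity
  set A := fejerMatrix N m a * pathLap N (β / N) with hA
  have hd0 : 0 ≤ β / N := by positivity
  -- Let `F` be the maximum of row `x` of exp(sA) W. The energy is at most K F, so an energy above
  -- the threshold forces F > (2 + 64β)K'/N: the 2 gives the hypothesis of the Nash inequality, the
  -- 64β absorbs the potential.
  refine le_add_inv_sqrt_of_deriv_le_neg_cube
    (E := fun t => (NormedSpace.exp ((2 * t) • A) * fejerMatrix N m a) x x)
    (by positivity) (by positivity)
    (fun t => hasDerivAt_exp_two_mul_generator (β / N) t x) ?_ ht htT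
  intro s hs hsT hbig
  set f : Fin (N + 1) → ℝ := fun u => (NormedSpace.exp (s • A) * fejerMatrix N m a) x u with hf
  set g : Fin (N + 1) → ℝ := fun u => NormedSpace.exp (s • A) x u with hg
  have hg0 : ∀ u, 0 ≤ g u := fun u => h.exp_generator_nonneg hd0 hs x u
  have hf0 : ∀ u, 0 ≤ f u := fun u => by
    simp only [hf, Matrix.mul_apply]
    exact Finset.sum_nonneg fun z _ => mul_nonneg (hg0 z) (h.fejerMatrix_nonneg z u)
  have hgK : ∑ u, g u ≤ K := hrow s hs hsT x
  have hfK : ∑ u, f u ≤ K' := by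
    simp only [hf, Matrix.mul_apply]
    rw [Finset.sum_comm]
    simp only [← Finset.mul_sum]
    calc _ ≤ ∑ z, g z * ((2 * m + 1) * C) :=
          Finset.sum_le_sum fun z _ => mul_le_mul_of_nonneg_left (h.sum_fejerMatrix_le z) (hg0 z)
      _ = (2 * m + 1) * C * ∑ z, g z := by rw [← Finset.sum_mul, mul_comm]
      _ ≤ _ := mul_le_mul_of_nonneg_left hgK (by positivity)
  have hE : (NormedSpace.exp ((2 * s) • A) * fejerMatrix N m a) x x = ∑ z, g z * f z :=
    exp_two_mul_generator_mul_fejerMatrix (β / N) s x x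
  obtain ⟨x₀, hx₀⟩ := Finite.exists_max f
  set F := f x₀ with hF
  have hF0 : 0 ≤ F := hf0 x₀
  have hEF : ∑ z, g z * f z ≤ K * F := by
    calc _ ≤ ∑ z, g z * F := Finset.sum_le_sum fun z _ => mul_le_mul_of_nonneg_left (hx₀ z) (hg0 z)
      _ = (∑ z, g z) * F := by rw [Finset.sum_mul]
      _ ≤ _ := mul_le_mul_of_nonneg_right hgK hF0
  have hE0 : 0 ≤ ∑ z, g z * f z := Finset.sum_nonneg fun z _ => mul_nonneg (hg0 z) (hf0 z)
  simp only [hE] at hbig ⊢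
  have hFbig : (2 + 64 * β) * K' / N < F := by
    have h1 : K * ((2 + 64 * β) * K' / N) < K * F := by
      rw [← mul_div_assoc]; exact hbig.trans_le hEF
    exact lt_of_mul_lt_mul_left h1 hK.le
  rw [div_lt_iff₀ hN0] at hFbig
  have hnash := cube_le_mul_sum_sq_sub hN hf0 hfK hx₀ (by
    rw [div_le_iff₀ hN0]; nlinarith [mul_nonneg hβ hK'0.le])
  have hS := sum_mul_pathLap_mulVec (β / N) f
  change 2 * ∑ u, f u * ∑ v, pathLap N (β / N) u v * f v ≤ _
  rw [hS]
  set G := ∑ i ∈ Finset.range N, (f (clampFin N ((i : ℤ) + 1)) - f (clampFin N i)) ^ 2 with hG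
  rw [← hF] at hnash
  -- The potential uses at most half of the dissipation F³/(16K') provided by Nash; twice the
  -- remainder is F³/(16K'), and F³ is at least the cube of the energy over K³.
  have hb : β / N * (f 0 ^ 2 + f (Fin.last N) ^ 2) ≤ F ^ 3 / (32 * K') := by
    have h1 : f 0 ^ 2 ≤ F ^ 2 := pow_le_pow_left₀ (hf0 _) (hx₀ _) 2
    have h2 : f (Fin.last N) ^ 2 ≤ F ^ 2 := pow_le_pow_left₀ (hf0 _) (hx₀ _) 2
    have h3 : β / N * (f 0 ^ 2 + f (Fin.last N) ^ 2) ≤ β / N * (2 * F ^ 2) :=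
      mul_le_mul_of_nonneg_left (by linarith) hd0
    refine h3.trans ?_
    rw [le_div_iff₀ (by positivity), div_mul_eq_mul_div, div_mul_eq_mul_div, div_le_iff₀ hN0]
    have h4 : 64 * β * K' ≤ F * N := by nlinarith
    nlinarith [mul_le_mul_of_nonneg_left h4 (sq_nonneg F)]
  have hGF : F ^ 3 / (16 * K') ≤ G := by
    rw [div_le_iff₀ (by positivity)]; linarith
  have hcube : (∑ z, g z * f z) ^ 3 ≤ K ^ 3 * F ^ 3 := by
    rw [← mul_pow]; exact pow_le_pow_left₀ hE0 hEF 3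
  have hlast : 1 / (16 * K' * K ^ 3) * (∑ z, g z * f z) ^ 3 ≤ F ^ 3 / (16 * K') := by
    calc _ ≤ 1 / (16 * K' * K ^ 3) * (K ^ 3 * F ^ 3) :=
          mul_le_mul_of_nonneg_left hcube (by positivity)
      _ = _ := by field_simp
  have hhalf : F ^ 3 / (32 * K') = F ^ 3 / (16 * K') / 2 := by rw [div_div]; congr 1; ring
  rw [hhalf] at hb
  linarith

/-- The heat kernel is controlled by the diagonal of `exp (t W S) W`. -/
theorem EllipticRates.exp_generator_apply_le (hm : 1 ≤ m) (h : EllipticRates m c C a)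
    (hc : 0 < c) {d t M : ℝ} (hd : 0 ≤ d) (ht : 0 ≤ t)
    (hM : ∀ x, (NormedSpace.exp ((2 * t) • (fejerMatrix N m a * pathLap N d))
      * fejerMatrix N m a) x x ≤ M) (x y : Fin (N + 1)) :
    NormedSpace.exp ((2 * t) • (fejerMatrix N m a * pathLap N d)) x y
      ≤ 4 * ((2 * m + 1) * C) / c ^ 2 * M := by
  have hC0 := h.moment_nonneg
  set A := fejerMatrix N m a * pathLap N d with hA
  set W := fejerMatrix N m a with hW
  have hQ := fun u v => h.exp_generator_nonneg (N := N) hd ht u v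
  -- The diagonal of `W` is at least c/2, so exp(tA) W dominates (c/2) exp(tA) entrywise.
  have hl2 : ∀ x, ∑ z, NormedSpace.exp (t • A) x z ^ 2 ≤ 2 / c * M := by
    intro x
    have h1 := hM x
    rw [exp_two_mul_generator_mul_fejerMatrix] at h1
    have h2 : ∀ z, NormedSpace.exp (t • A) x z * (c / 2)
        ≤ (NormedSpace.exp (t • A) * W) x z := by
      intro z
      refine (mul_le_mul_of_nonneg_left (h.le_fejerMatrix_self hm z) (hQ x z)).trans ?_
      rw [Matrix.mul_apply]
      exact Finset.single_le_sum (f := fun u => NormedSpace.exp (t • A) x u * W u z)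
        (fun u _ => mul_nonneg (hQ x u) (h.fejerMatrix_nonneg u z)) (Finset.mem_univ z)
    have h3 : (c / 2) * ∑ z, NormedSpace.exp (t • A) x z ^ 2 ≤ M := by
      refine le_trans ?_ h1
      rw [Finset.mul_sum]
      refine Finset.sum_le_sum fun z _ => ?_
      have := mul_le_mul_of_nonneg_left (h2 z) (hQ x z)
      calc _ = NormedSpace.exp (t • A) x z * (NormedSpace.exp (t • A) x z * (c / 2)) := by ring
        _ ≤ _ := this
    rw [div_mul_eq_mul_div, le_div_iff₀ hc]
    linarith
  have h1 : (c / 2) * NormedSpace.exp ((2 * t) • A) x y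
      ≤ (NormedSpace.exp ((2 * t) • A) * W) x y := by
    have hQ2 := fun v => h.exp_generator_nonneg (N := N) hd (by positivity : 0 ≤ 2 * t) x v
    rw [mul_comm]
    refine (mul_le_mul_of_nonneg_left (h.le_fejerMatrix_self hm y) (hQ2 y)).trans ?_
    rw [Matrix.mul_apply]
    exact Finset.single_le_sum (f := fun u => NormedSpace.exp ((2 * t) • A) x u * W u y)
      (fun u _ => mul_nonneg (hQ2 u) (h.fejerMatrix_nonneg u y)) (Finset.mem_univ y)
  -- Schur test: the product of the two rows is split into squares, and the row sums of `W` are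
  -- bounded.
  have h2 : (NormedSpace.exp ((2 * t) • A) * W) x y
      ≤ ∑ z, ∑ u, (W z u * (NormedSpace.exp (t • A) x z ^ 2 / 2)
        + W z u * (NormedSpace.exp (t • A) y u ^ 2 / 2)) := by
    rw [exp_two_mul_generator_mul_fejerMatrix]
    refine Finset.sum_le_sum fun z _ => ?_
    rw [Matrix.mul_apply, Finset.mul_sum]
    refine Finset.sum_le_sum fun u _ => ?_
    rw [fejerMatrix_symm N m a u z, ← mul_add]
    have h3 := h.fejerMatrix_nonneg z u
    have h4 : NormedSpace.exp (t • A) x z * NormedSpace.exp (t • A) y u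
        ≤ NormedSpace.exp (t • A) x z ^ 2 / 2 + NormedSpace.exp (t • A) y u ^ 2 / 2 := by
      linarith [two_mul_le_add_sq (NormedSpace.exp (t • A) x z) (NormedSpace.exp (t • A) y u)]
    calc _ = W z u * (NormedSpace.exp (t • A) x z * NormedSpace.exp (t • A) y u) := by ring
      _ ≤ _ := mul_le_mul_of_nonneg_left h4 h3
  have hquad : ∀ w : Fin (N + 1), ∑ z, ∑ u, W z u * (NormedSpace.exp (t • A) w z ^ 2 / 2)
      ≤ (2 * m + 1) * C * (1 / c * M) := by
    intro w
    simp only [← Finset.sum_mul]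
    calc _ ≤ ∑ z, (2 * m + 1) * C * (NormedSpace.exp (t • A) w z ^ 2 / 2) :=
          Finset.sum_le_sum fun z _ =>
            mul_le_mul_of_nonneg_right (h.sum_fejerMatrix_le z) (by positivity)
      _ = (2 * m + 1) * C * ((∑ z, NormedSpace.exp (t • A) w z ^ 2) / 2) := by
          rw [← Finset.mul_sum, Finset.sum_div]
      _ ≤ (2 * m + 1) * C * ((2 / c * M) / 2) :=
          mul_le_mul_of_nonneg_left (by linarith [hl2 w]) (by positivity)
      _ = _ := by ring
  have hquad' : ∑ z, ∑ u, W z u * (NormedSpace.exp (t • A) y u ^ 2 / 2)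
      ≤ (2 * m + 1) * C * (1 / c * M) := by
    rw [Finset.sum_comm]
    refine le_trans (le_of_eq ?_) (hquad y)
    exact Finset.sum_congr rfl fun z _ => Finset.sum_congr rfl fun u _ => by
      rw [hW, fejerMatrix_symm N m a u z]
  simp only [Finset.sum_add_distrib] at h2
  have h5 : (c / 2) * NormedSpace.exp ((2 * t) • A) x y ≤ 2 * ((2 * m + 1) * C * (1 / c * M)) := by
    linarith [hquad x]
  have h6 : 4 * ((2 * m + 1) * C) / c ^ 2 * M
      = (2 / c) * (2 * ((2 * m + 1) * C * (1 / c * M))) := by field_simp; ring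
  rw [h6, div_mul_eq_mul_div, le_div_iff₀ hc]
  linarith

end OnDiagonal

/-! ### Weighted pointwise bounds for the dominating kernel. -/

section HeatKernel

variable {N m : ℕ} {c C : ℝ} {a : ℕ → ℝ}

/-- Exponential moments of the columns of the heat kernel are controlled by those of its rows. -/
theorem EllipticRates.sum_exp_generator_mul_exp_le_of_row (hm : 1 ≤ m) (h : EllipticRates m c C a)
    (hc : 0 < c) {d t θ R : ℝ} (hd : 0 ≤ d) (ht : 0 ≤ t) (hθ : 0 ≤ θ) (y : Fin (N + 1))
    (hR : ∑ u, NormedSpace.exp (t • (fejerMatrix N m a * pathLap N d)) y u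
      * Real.exp (θ * |((y : ℕ) : ℝ) - ((u : ℕ) : ℝ)|) ≤ R) :
    ∑ z, NormedSpace.exp (t • (fejerMatrix N m a * pathLap N d)) z y
        * Real.exp (θ * |((z : ℕ) : ℝ) - ((y : ℕ) : ℝ)|)
      ≤ 2 / c * ((2 * m + 1) * C * Real.exp (θ * m) * R) := by
  have hC0 := h.moment_nonneg
  set A := fejerMatrix N m a * pathLap N d with hA
  have hQ := fun u v => h.exp_generator_nonneg (N := N) hd ht u v
  -- Column entries are dominated by (exp(tA) W)(z, y), which symmetry turns into an average of row
  -- `y`.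
  have h1 : ∀ z, (c / 2) * NormedSpace.exp (t • A) z y
      ≤ ∑ u, NormedSpace.exp (t • A) y u * fejerMatrix N m a u z := by
    intro z
    rw [← Matrix.mul_apply, hA, exp_generator_mul_fejerMatrix_symm d t y z, ← hA, mul_comm]
    refine (mul_le_mul_of_nonneg_left (h.le_fejerMatrix_self hm y) (hQ z y)).trans ?_
    rw [Matrix.mul_apply]
    exact Finset.single_le_sum
      (f := fun u => NormedSpace.exp (t • A) z u * fejerMatrix N m a u y)
      (fun u _ => mul_nonneg (hQ z u) (h.fejerMatrix_nonneg u y)) (Finset.mem_univ y)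
  have h2 : (c / 2) * ∑ z, NormedSpace.exp (t • A) z y
        * Real.exp (θ * |((z : ℕ) : ℝ) - ((y : ℕ) : ℝ)|)
      ≤ (2 * m + 1) * C * Real.exp (θ * m) * R := by
    calc _ = ∑ z, (c / 2 * NormedSpace.exp (t • A) z y)
            * Real.exp (θ * |((z : ℕ) : ℝ) - ((y : ℕ) : ℝ)|) := by
          rw [Finset.mul_sum]; exact Finset.sum_congr rfl fun _ _ => by ring
      _ ≤ ∑ z, (∑ u, NormedSpace.exp (t • A) y u * fejerMatrix N m a u z)
            * Real.exp (θ * |((z : ℕ) : ℝ) - ((y : ℕ) : ℝ)|) :=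
          Finset.sum_le_sum fun z _ => mul_le_mul_of_nonneg_right (h1 z) (Real.exp_pos _).le
      _ = ∑ u, NormedSpace.exp (t • A) y u * ∑ z, fejerMatrix N m a u z
            * Real.exp (θ * |((z : ℕ) : ℝ) - ((y : ℕ) : ℝ)|) := by
          simp only [Finset.sum_mul, Finset.mul_sum]
          rw [Finset.sum_comm]
          exact Finset.sum_congr rfl fun _ _ => Finset.sum_congr rfl fun _ _ => by ring
      _ ≤ ∑ u, NormedSpace.exp (t • A) y u * ((2 * m + 1) * C
            * (Real.exp (θ * m) * Real.exp (θ * |((y : ℕ) : ℝ) - ((u : ℕ) : ℝ)|))) := by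
          refine Finset.sum_le_sum fun u _ => mul_le_mul_of_nonneg_left ?_ (hQ y u)
          refine h.sum_fejerMatrix_mul_le u (by positivity) fun z hz => ?_
          rw [← Real.exp_add, Real.exp_le_exp, ← mul_add]
          refine mul_le_mul_of_nonneg_left ?_ hθ
          have h3 := abs_sub_le ((z : ℕ) : ℝ) ((u : ℕ) : ℝ) ((y : ℕ) : ℝ)
          rw [abs_sub_comm ((z : ℕ) : ℝ) ((u : ℕ) : ℝ),
            abs_sub_comm ((u : ℕ) : ℝ) ((y : ℕ) : ℝ)] at h3
          linarith
      _ = (2 * m + 1) * C * Real.exp (θ * m) * ∑ u, NormedSpace.exp (t • A) y u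
            * Real.exp (θ * |((y : ℕ) : ℝ) - ((u : ℕ) : ℝ)|) := by
          rw [Finset.mul_sum]; exact Finset.sum_congr rfl fun _ _ => by ring
      _ ≤ _ := mul_le_mul_of_nonneg_left hR (by positivity)
  rw [div_mul_eq_mul_div, le_div_iff₀ hc]
  linarith

/-- A pointwise bound and exponential moments at time `t` give a weighted pointwise bound at time
`2t`. -/
theorem mul_apply_mul_exp_le {Q : Matrix (Fin (N + 1)) (Fin (N + 1)) ℝ} (hQ : ∀ x y, 0 ≤ Q x y)
    {θ M R₁ R₂ : ℝ} (hθ : 0 ≤ θ) (hM : ∀ x y, Q x y ≤ M)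
    (hrow : ∀ x, ∑ z, Q x z * Real.exp (2 * θ * |((x : ℕ) : ℝ) - ((z : ℕ) : ℝ)|) ≤ R₁)
    (hcol : ∀ y, ∑ z, Q z y * Real.exp (2 * θ * |((z : ℕ) : ℝ) - ((y : ℕ) : ℝ)|) ≤ R₂)
    (x y : Fin (N + 1)) :
    (Q * Q) x y * Real.exp (θ * |((x : ℕ) : ℝ) - ((y : ℕ) : ℝ)|) ≤ M * (R₁ + R₂) := by
  have hM0 : 0 ≤ M := (hQ x y).trans (hM x y)
  rw [Matrix.mul_apply, Finset.sum_mul]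
  calc _ ≤ ∑ z, (M * (Q x z * Real.exp (2 * θ * |((x : ℕ) : ℝ) - ((z : ℕ) : ℝ)|))
          + M * (Q z y * Real.exp (2 * θ * |((z : ℕ) : ℝ) - ((y : ℕ) : ℝ)|))) := by
        refine Finset.sum_le_sum fun z _ => ?_
        -- The longer of the two legs has length at least |x - y|/2, so it carries the weight at the
        -- doubled rate; the kernel of the other leg is bounded by `M`.
        have h1 : Real.exp (θ * |((x : ℕ) : ℝ) - ((y : ℕ) : ℝ)|)
            ≤ Real.exp (2 * θ * |((x : ℕ) : ℝ) - ((z : ℕ) : ℝ)|)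
              + Real.exp (2 * θ * |((z : ℕ) : ℝ) - ((y : ℕ) : ℝ)|) := by
          have h2 := abs_sub_le ((x : ℕ) : ℝ) ((z : ℕ) : ℝ) ((y : ℕ) : ℝ)
          have h3 := Real.exp_pos (2 * θ * |((x : ℕ) : ℝ) - ((z : ℕ) : ℝ)|)
          have h4 := Real.exp_pos (2 * θ * |((z : ℕ) : ℝ) - ((y : ℕ) : ℝ)|)
          rcases le_total |((x : ℕ) : ℝ) - ((z : ℕ) : ℝ)| |((z : ℕ) : ℝ) - ((y : ℕ) : ℝ)| with h | h
          · have : Real.exp (θ * |((x : ℕ) : ℝ) - ((y : ℕ) : ℝ)|)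
                ≤ Real.exp (2 * θ * |((z : ℕ) : ℝ) - ((y : ℕ) : ℝ)|) := by
              rw [Real.exp_le_exp]; nlinarith
            linarith
          · have : Real.exp (θ * |((x : ℕ) : ℝ) - ((y : ℕ) : ℝ)|)
                ≤ Real.exp (2 * θ * |((x : ℕ) : ℝ) - ((z : ℕ) : ℝ)|) := by
              rw [Real.exp_le_exp]; nlinarith
            linarith
        have hxz := hQ x z
        have hzy := hQ z y
        set e₁ := Real.exp (2 * θ * |((x : ℕ) : ℝ) - ((z : ℕ) : ℝ)|) with he₁
        set e₂ := Real.exp (2 * θ * |((z : ℕ) : ℝ) - ((y : ℕ) : ℝ)|) with he₂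
        have he₁0 : 0 ≤ e₁ := (Real.exp_pos _).le
        have he₂0 : 0 ≤ e₂ := (Real.exp_pos _).le
        calc _ ≤ Q x z * Q z y * (e₁ + e₂) := mul_le_mul_of_nonneg_left h1 (mul_nonneg hxz hzy)
          _ = Q z y * (Q x z * e₁) + Q x z * (Q z y * e₂) := by ring
          _ ≤ _ := add_le_add (mul_le_mul_of_nonneg_right (hM z y) (mul_nonneg hxz he₁0))
              (mul_le_mul_of_nonneg_right (hM x z) (mul_nonneg hzy he₂0))
    _ = M * (∑ z, Q x z * Real.exp (2 * θ * |((x : ℕ) : ℝ) - ((z : ℕ) : ℝ)|)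
          + ∑ z, Q z y * Real.exp (2 * θ * |((z : ℕ) : ℝ) - ((y : ℕ) : ℝ)|)) := by
        rw [Finset.sum_add_distrib, ← Finset.mul_sum, ← Finset.mul_sum, mul_add]
    _ ≤ _ := mul_le_mul_of_nonneg_left (add_le_add (hrow x) (hcol y)) hM0

set_option maxHeartbeats 1000000 in
/-- Uniform exponentially weighted bounds for the heat kernel of `W S` up to times of order `N²`. -/
theorem exists_exp_generator_bound (hm : 1 ≤ m) (hc : 0 < c) (hC : 0 < C) {β τ κ : ℝ} (hβ : 0 ≤ β)
    (hτ : 1 ≤ τ) (hκ : 0 < κ) :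
    ∃ K : ℝ, 0 < K ∧ ∀ (N : ℕ) (a : ℕ → ℝ), 1 ≤ N → EllipticRates m c C a →
      ∀ s : ℝ, 0 ≤ s → s ≤ (N : ℝ) ^ 2 * τ →
        (∀ x : Fin (N + 1), ∑ y, NormedSpace.exp (s • (fejerMatrix N m a * pathLap N (β / N))) x y
          * Real.exp (κ * |((x : ℕ) : ℝ) - ((y : ℕ) : ℝ)| / max (Real.sqrt s) 1) ≤ K) ∧
        (0 < s → ∀ x y : Fin (N + 1),
          NormedSpace.exp (s • (fejerMatrix N m a * pathLap N (β / N))) x y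
          * Real.exp (κ * |((x : ℕ) : ℝ) - ((y : ℕ) : ℝ)| / max (Real.sqrt s) 1)
            ≤ K * ((N : ℝ)⁻¹ + (Real.sqrt s)⁻¹)) := by
  -- A rate θ ≥ θ₀/N meets both requirements of the supersolution, 6β/N ≤ θ and 1 ≤ θN. Enlarging κ
  -- to `κ'` makes κ'/L admissible for every length L ≤ N√τ.
  set θ₀ : ℝ := 1 + 6 * β with hθ₀
  have hθ₀1 : 1 ≤ θ₀ := by linarith
  have hτs : 1 ≤ Real.sqrt τ := Real.one_le_sqrt.2 hτ
  set κ' : ℝ := max κ (θ₀ * Real.sqrt τ) with hκ'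
  have hκκ' : κ ≤ κ' := le_max_left _ _
  have hκ'2 : θ₀ * Real.sqrt τ ≤ κ' := le_max_right _ _
  have hκ'0 : 0 < κ' := hκ.trans_le hκκ'
  have hθ₀κ' : θ₀ ≤ κ' := by nlinarith
  -- The doubled rate leaves room for the splitting at s/2, which needs moments at rate 2θ.
  set R : ℝ := 6 * Real.exp (Real.exp ((2 * κ') ^ 2 / 2)
    * ((2 * m + 1) * C * Real.exp (2 * κ' * m)) * (4 * κ' ^ 2)) with hR
  have hR0 : 0 < R := by positivity
  set R₂ : ℝ := 2 / c * ((2 * m + 1) * C * Real.exp (2 * κ' * m) * R) with hR₂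
  have hR₂0 : 0 < R₂ := by positivity
  set e₀ : ℝ := R * ((2 + 64 * β) * ((2 * m + 1) * C * R)) with he₀
  have he₀0 : 0 < e₀ := by positivity
  set c₁ : ℝ := 1 / (16 * ((2 * m + 1) * C * R) * R ^ 3) with hc₁
  have hc₁0 : 0 < c₁ := by positivity
  set M₀ : ℝ := 4 * ((2 * m + 1) * C) / c ^ 2 * (e₀ + 1 / Real.sqrt (c₁ / 2)) with hM₀
  have hM₀0 : 0 < M₀ := by positivity
  refine ⟨R + M₀ * (R + R₂), by positivity, fun N a hN h s hs hsN => ?_⟩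
  have hN0 : (0 : ℝ) < N := by exact_mod_cast hN
  have hN1 : (1 : ℝ) ≤ N := by exact_mod_cast hN
  have hd0 : 0 ≤ β / N := by positivity
  set A := fejerMatrix N m a * pathLap N (β / N) with hA
  -- row moments at an admissible rate
  have hrowθ : ∀ θ t : ℝ, θ₀ / N ≤ θ → θ ≤ 2 * κ' → 0 ≤ t → θ ^ 2 * t ≤ 4 * κ' ^ 2 →
      ∀ x : Fin (N + 1), ∑ y, NormedSpace.exp (t • A) x y
        * Real.exp (θ * |((x : ℕ) : ℝ) - ((y : ℕ) : ℝ)|) ≤ R := by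
    intro θ t hθ1 hθ2 ht hθt x
    have h1 : θ₀ ≤ θ * N := by rwa [div_le_iff₀ hN0] at hθ1
    have h2 : 6 * (β / N) ≤ θ := by
      rw [← mul_div_assoc, div_le_iff₀ hN0]; linarith
    refine (h.sum_exp_generator_mul_exp_le hd0 h2 (by linarith) hθ2 ht x).trans ?_
    refine mul_le_mul_of_nonneg_left (Real.exp_le_exp.2 ?_) (by norm_num)
    exact mul_le_mul_of_nonneg_left hθt (by positivity)
  have hrow1 : ∀ t, 0 ≤ t → t ≤ (N : ℝ) ^ 2 * τ → ∀ x : Fin (N + 1),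
      ∑ y, NormedSpace.exp (t • A) x y ≤ R := by
    intro t ht htN x
    have h1 : θ₀ / N ≤ θ₀ := div_le_self (by linarith) hN1
    have h2 : (θ₀ / N) ^ 2 * t ≤ 4 * κ' ^ 2 := by
      calc (θ₀ / N) ^ 2 * t ≤ (θ₀ / N) ^ 2 * ((N : ℝ) ^ 2 * τ) :=
            mul_le_mul_of_nonneg_left htN (sq_nonneg _)
        _ = (θ₀ * Real.sqrt τ) ^ 2 := by
            rw [mul_pow, Real.sq_sqrt (by linarith)]; field_simp
        _ ≤ κ' ^ 2 := pow_le_pow_left₀ (by positivity) hκ'2 2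
        _ ≤ _ := by linarith [sq_nonneg κ']
    refine le_trans (Finset.sum_le_sum fun y _ => ?_)
      (hrowθ (θ₀ / N) t le_rfl (by linarith) ht h2 x)
    refine le_mul_of_one_le_right (h.exp_generator_nonneg hd0 ht x y) (Real.one_le_exp ?_)
    positivity
  set L := max (Real.sqrt s) 1 with hL
  have hL1 : 1 ≤ L := le_max_right _ _
  have hL0 : 0 < L := by linarith
  have hsL : s ≤ L ^ 2 := by
    rw [← Real.sq_sqrt hs]; exact pow_le_pow_left₀ (Real.sqrt_nonneg _) (le_max_left _ _) 2
  have hLN : L ≤ N * Real.sqrt τ := by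
    refine max_le ?_ (by nlinarith)
    calc Real.sqrt s ≤ Real.sqrt ((N : ℝ) ^ 2 * τ) := Real.sqrt_le_sqrt hsN
      _ = N * Real.sqrt τ := by
        rw [Real.sqrt_mul (sq_nonneg _), Real.sqrt_sq hN0.le]
  set θ := κ' / L with hθ
  have hθ0 : 0 < θ := by positivity
  have hθκ' : θ ≤ κ' := div_le_self hκ'0.le hL1
  have hθN : θ₀ / N ≤ θ := by
    rw [hθ, div_le_div_iff₀ hN0 hL0]
    calc θ₀ * L ≤ θ₀ * (N * Real.sqrt τ) := mul_le_mul_of_nonneg_left hLN (by linarith)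
      _ = (θ₀ * Real.sqrt τ) * N := by ring
      _ ≤ κ' * N := mul_le_mul_of_nonneg_right hκ'2 hN0.le
  have hθs : θ ^ 2 * s ≤ κ' ^ 2 := by
    rw [hθ, div_pow, div_mul_eq_mul_div, div_le_iff₀ (by positivity)]
    exact mul_le_mul_of_nonneg_left hsL (sq_nonneg _)
  have hweight : ∀ x y : Fin (N + 1),
      Real.exp (κ * |((x : ℕ) : ℝ) - ((y : ℕ) : ℝ)| / L)
        ≤ Real.exp (θ * |((x : ℕ) : ℝ) - ((y : ℕ) : ℝ)|) := by
    intro x y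
    rw [Real.exp_le_exp, hθ, div_mul_eq_mul_div]
    gcongr
  refine ⟨fun x => ?_, fun hs0 x y => ?_⟩
  · have h1 := hrowθ θ s hθN (by linarith) hs (by linarith [sq_nonneg κ']) x
    have h2 : 0 ≤ M₀ * (R + R₂) := by positivity
    refine le_trans (Finset.sum_le_sum fun y _ => ?_) (h1.trans (by linarith))
    exact mul_le_mul_of_nonneg_left (hweight x y) (h.exp_generator_nonneg hd0 hs x y)
  · have hQ := fun u v => h.exp_generator_nonneg (N := N) hd0 (by linarith : 0 ≤ s / 2) u v
    have hθ2 : (2 * θ) ^ 2 * (s / 2) ≤ 4 * κ' ^ 2 := by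
      have : (2 * θ) ^ 2 * (s / 2) = 2 * (θ ^ 2 * s) := by ring
      linarith [sq_nonneg κ']
    have hrow2 := hrowθ (2 * θ) (s / 2) (by linarith) (by linarith) (by linarith) hθ2
    have hcol2 : ∀ y : Fin (N + 1), ∑ z, NormedSpace.exp ((s / 2) • A) z y
        * Real.exp (2 * θ * |((z : ℕ) : ℝ) - ((y : ℕ) : ℝ)|) ≤ R₂ := by
      intro y
      refine (h.sum_exp_generator_mul_exp_le_of_row hm hc hd0 (by linarith) (by linarith) y
        (hrow2 y)).trans ?_
      have : Real.exp (2 * θ * m) ≤ Real.exp (2 * κ' * m) := by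
        rw [Real.exp_le_exp]; gcongr
      rw [hR₂]
      refine mul_le_mul_of_nonneg_left ?_ (by positivity)
      exact mul_le_mul_of_nonneg_right (mul_le_mul_of_nonneg_left this (by positivity)) hR0.le
    have hdiag : ∀ x y : Fin (N + 1),
        NormedSpace.exp ((s / 2) • A) x y ≤ M₀ * ((N : ℝ)⁻¹ + (Real.sqrt s)⁻¹) := by
      intro x y
      -- Both on-diagonal lemmas speak of time 2t, so t = s/4 yields the kernel at s/2.
      have h1 := h.exp_generator_apply_le hm hc hd0 (by linarith : 0 ≤ s / 4)
        (fun x => h.exp_generator_mul_fejerMatrix_self_le hm hc hN hβ hR0 hrow1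
          (by linarith : 0 < s / 4) (by linarith) x) x y
      rw [show 2 * (s / 4) = s / 2 by ring] at h1
      refine h1.trans ?_
      have hcoef : 0 ≤ 4 * ((2 * m + 1) * C) / c ^ 2 := by positivity
      refine le_trans (mul_le_mul_of_nonneg_left ?_ hcoef) (mul_assoc _ _ _).ge
      rw [← he₀, ← hc₁, show 2 * c₁ * (s / 4) = c₁ / 2 * s by ring,
        Real.sqrt_mul (by positivity), div_eq_mul_inv e₀, one_div, one_div, mul_inv]
      have h2 : 0 ≤ (N : ℝ)⁻¹ := by positivity
      have h3 : 0 ≤ (Real.sqrt s)⁻¹ := by positivity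
      have h4 : 0 ≤ (Real.sqrt (c₁ / 2))⁻¹ := by positivity
      have h5 := mul_nonneg h2 h4
      have h6 := mul_nonneg h3 he₀0.le
      linarith
    have hfin := mul_apply_mul_exp_le hQ hθ0.le hdiag hrow2 hcol2 x y
    rw [← Matrix.exp_smul_add, add_halves] at hfin
    have hQs := h.exp_generator_nonneg (N := N) hd0 hs x y
    refine (mul_le_mul_of_nonneg_left (hweight x y) hQs).trans (hfin.trans ?_)
    have h5 : 0 ≤ R * ((N : ℝ)⁻¹ + (Real.sqrt s)⁻¹) := by positivity
    linarith

end HeatKernel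

/-! ### Modified rates and the Robin kernel. -/

section Robin

variable {N m : ℕ} {lam c C : ℝ} {α : ℕ → ℝ}

theorem JumpCoeffs.modCoeff_le (h : JumpCoeffs N m lam c C α) (hN : 1 ≤ N) {k : ℕ}
    (hk : k ∈ Finset.Icc 1 m) : modCoeff N m lam α k ≤ (1 + lam ^ 2 * m) * α k := by
  have hk' := Finset.mem_Icc.1 hk
  have hα := h.pos k hk
  have hN1 : (N : ℝ)⁻¹ ≤ 1 := inv_le_one_of_one_le₀ (by exact_mod_cast hN)
  have hN0 : 0 ≤ (N : ℝ)⁻¹ := by positivity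
  have hkm : (k : ℝ) ≤ m := by exact_mod_cast hk'.2
  have h1 : (N : ℝ)⁻¹ * lam ^ 2 * (((k : ℝ) - 2) / 2) * α k ≤ lam ^ 2 * m * α k := by
    refine mul_le_mul_of_nonneg_right ?_ hα.le
    have h2 : (N : ℝ)⁻¹ * lam ^ 2 ≤ lam ^ 2 := by nlinarith [sq_nonneg lam]
    have h3 : 0 ≤ (N : ℝ)⁻¹ * lam ^ 2 := by positivity
    have h4 : ((k : ℝ) - 2) / 2 ≤ m := by linarith [(Nat.cast_nonneg k : (0 : ℝ) ≤ k)]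
    have h5 : (0 : ℝ) ≤ m := Nat.cast_nonneg m
    nlinarith
  have h6 : 0 ≤ (N : ℝ)⁻¹ * (lam ^ 2 / (k : ℝ))
      * ∑ l ∈ Finset.Icc (k + 1) m, (2 * (l : ℝ) - (k : ℝ)) * α l := by
    refine mul_nonneg (by positivity) (Finset.sum_nonneg fun l hl => ?_)
    rw [Finset.mem_Icc] at hl
    have h7 : (k : ℝ) ≤ l := by exact_mod_cast (by omega : k ≤ l)
    have h8 : (0 : ℝ) ≤ l := Nat.cast_nonneg l
    exact mul_nonneg (by linarith) (h.pos l (Finset.mem_Icc.2 ⟨by omega, hl.2⟩)).le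
  unfold modCoeff
  linarith

/-- The correction to α_1 is λ²/N times α_1/2 + ∑ (2ℓ - 1) α_ℓ, and 2ℓ - 1 ≤ ℓ² bounds this sum by
the second moment. -/
theorem JumpCoeffs.le_modCoeff_one (h : JumpCoeffs N m lam c C α) (hm : 1 ≤ m) (hN : 1 ≤ N)
    (hNbig : 2 * lam ^ 2 * C ≤ c * N) : c / 2 ≤ modCoeff N m lam α 1 := by
  have hN0 : (0 : ℝ) < N := by exact_mod_cast hN
  have hins : Finset.Icc 1 m = insert 1 (Finset.Icc (1 + 1) m) := by
    ext k; simp only [Finset.mem_Icc, Finset.mem_insert]; omega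
  have hmom := h.moment
  rw [hins, Finset.sum_insert (by simp)] at hmom
  have h1 : ∑ l ∈ Finset.Icc (1 + 1) m, (2 * (l : ℝ) - ((1 : ℕ) : ℝ)) * α l
      ≤ ∑ l ∈ Finset.Icc (1 + 1) m, (l : ℝ) ^ 2 * α l := by
    refine Finset.sum_le_sum fun l hl => ?_
    rw [Finset.mem_Icc] at hl
    refine mul_le_mul_of_nonneg_right ?_ (h.pos l (Finset.mem_Icc.2 ⟨by omega, hl.2⟩)).le
    push_cast
    nlinarith [sq_nonneg ((l : ℝ) - 1)]
  have hα := h.pos 1 (Finset.mem_Icc.2 ⟨le_rfl, hm⟩)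
  have hell := h.elliptic
  set S₁ := ∑ l ∈ Finset.Icc (1 + 1) m, (2 * (l : ℝ) - ((1 : ℕ) : ℝ)) * α l with hS₁
  have h2 : modCoeff N m lam α 1 = α 1 - (lam ^ 2 * (α 1 / 2 + S₁)) / N := by
    unfold modCoeff
    rw [← hS₁]
    push_cast
    field_simp
    ring
  have h3 : (lam ^ 2 * (α 1 / 2 + S₁)) / N ≤ c / 2 := by
    rw [div_le_iff₀ hN0]
    have h4 : α 1 / 2 + S₁ ≤ C := by
      simp only [Nat.cast_one, one_pow, one_mul] at hmom
      linarith
    have := mul_le_mul_of_nonneg_left h4 (sq_nonneg lam)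
    linarith
  rw [h2]; linarith

theorem JumpCoeffs.ellipticRates (h : JumpCoeffs N m lam c C α) (hm : 1 ≤ m) (hN : 1 ≤ N)
    (hNbig : 2 * lam ^ 2 * C ≤ c * N) :
    EllipticRates m (c / 2) ((1 + lam ^ 2 * m) * C) (modCoeff N m lam α) where
  nonneg := h.mod_nonneg
  elliptic := h.le_modCoeff_one hm hN hNbig
  moment := by
    calc _ ≤ ∑ k ∈ Finset.Icc 1 m, (1 + lam ^ 2 * m) * ((k : ℝ) ^ 2 * α k) := by
          refine Finset.sum_le_sum fun k hk => ?_
          rw [mul_left_comm]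
          exact mul_le_mul_of_nonneg_left (h.modCoeff_le hN hk) (sq_nonneg _)
      _ = (1 + lam ^ 2 * m) * ∑ k ∈ Finset.Icc 1 m, (k : ℝ) ^ 2 * α k := by
          rw [Finset.mul_sum]
      _ ≤ _ := mul_le_mul_of_nonneg_left h.moment (by positivity)

theorem robinKernel_eq {a : ℕ → ℝ} (hm : 1 ≤ m) (hN : 2 * m ≤ N + 1) (Am Ap S T : ℝ)
    (x y : Fin (N + 1)) :
    robinKernel N m a Am Ap S T x y
      = NormedSpace.exp ((T - S) • robinMatrix N m a Am Ap) x y := by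
  rw [robinKernel, toMatrix'_robinGen hm hN]

theorem robinKernel_nonneg {a : ℕ → ℝ} (hm : 1 ≤ m) (hN : 2 * m ≤ N + 1)
    (ha : ∀ k ∈ Finset.Icc 1 m, 0 ≤ a k) (Am Ap : ℝ) {S T : ℝ} (hST : S ≤ T)
    (x y : Fin (N + 1)) : 0 ≤ robinKernel N m a Am Ap S T x y := by
  rw [robinKernel_eq hm hN]
  -- Only the signs of the rates matter, so the constants are read off from `a` itself.
  have h : EllipticRates m (a 1) _ a := ⟨ha, le_rfl, le_rfl⟩
  refine (Matrix.exp_apply_nonneg_le (fun u v huv => ?_) (fun _ _ => le_rfl) x y).1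
  exact mul_nonneg (by linarith) (h.robinMatrix_offDiag_nonneg Am Ap huv)

/-- A bound on the row sums of the Robin heat kernel that needs no ellipticity. -/
theorem sum_robinKernel_le {a : ℕ → ℝ} (hm : 1 ≤ m) (hN : 2 * m ≤ N + 1)
    (ha : ∀ k ∈ Finset.Icc 1 m, 0 ≤ a k) (Am Ap : ℝ) {S T : ℝ} (hST : S ≤ T) (x : Fin (N + 1)) :
    ∑ y, robinKernel N m a Am Ap S T x y ≤ Real.exp (N * (|Am| + |Ap|) * (T - S)) := by
  simp only [robinKernel_eq hm hN]
  have h : EllipticRates m (a 1) _ a := ⟨ha, le_rfl, le_rfl⟩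
  have h1 := Matrix.sum_exp_smul_mul_le (A := robinMatrix N m a Am Ap) (φ := fun _ => 1)
    (r := N * (|Am| + |Ap|)) (t := T - S)
    (fun u v huv => h.robinMatrix_offDiag_nonneg Am Ap huv) ?_ (by linarith) x
  · simpa only [mul_one] using h1
  intro u
  have h2 := fejerMatrix_mul_pathLap_mulVec N m a (fun _ => 1) u
  have h3 : ∀ k : ℤ, ∀ z : ℤ, latLap k (fun _ => (1 : ℝ)) z = 0 := fun k z => by
    simp only [latLap]; norm_num
  simp only [h3, mul_one, mul_zero, Finset.sum_const_zero] at h2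
  simp only [robinMatrix, mul_one, Finset.sum_add_distrib, ← Finset.mul_sum, h2, mul_zero,
    zero_add, Finset.sum_ite_eq, Finset.mem_univ, if_true]
  have hN0 : (0 : ℝ) ≤ N := Nat.cast_nonneg N
  have h4 : -(N * Am) ≤ N * |Am| := by nlinarith [neg_abs_le Am]
  have h5 : -(N * Ap) ≤ N * |Ap| := by nlinarith [neg_abs_le Ap]
  have h6 : 0 ≤ N * |Am| := by positivity
  have h7 : 0 ≤ N * |Ap| := by positivity
  rw [mul_add]
  refine add_le_add ?_ ?_ <;> split_ifs <;> assumption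

theorem inv_le_onDiagBound (hN : 1 ≤ N) (S T : ℝ) : (N : ℝ)⁻¹ ≤ onDiagBound N S T := by
  have h1 : (N : ℝ)⁻¹ ≤ 1 := inv_le_one_of_one_le₀ (by exact_mod_cast hN)
  unfold onDiagBound
  split_ifs
  · exact h1
  · exact le_min (le_add_of_nonneg_right (by positivity)) h1

theorem offDiagWeight_le {κ : ℝ} (hκ : 0 ≤ κ) (S T : ℝ) (x y : Fin (N + 1)) :
    offDiagWeight N κ S T x y ≤ Real.exp (κ * N) := by
  unfold offDiagWeight
  rw [Real.exp_le_exp]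
  have hx : ((x : ℕ) : ℝ) ≤ N := by exact_mod_cast Nat.lt_succ_iff.1 x.2
  have hy : ((y : ℕ) : ℝ) ≤ N := by exact_mod_cast Nat.lt_succ_iff.1 y.2
  have hx0 : (0 : ℝ) ≤ ((x : ℕ) : ℝ) := Nat.cast_nonneg _
  have hy0 : (0 : ℝ) ≤ ((y : ℕ) : ℝ) := Nat.cast_nonneg _
  have h1 : |((x : ℕ) : ℝ) - ((y : ℕ) : ℝ)| ≤ N := by rw [abs_le]; constructor <;> linarith
  refine (div_le_self (by positivity) (le_max_right _ _)).trans ?_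
  exact mul_le_mul_of_nonneg_left h1 hκ

theorem sqrt_sq_mul_eq (N : ℕ) (r : ℝ) : Real.sqrt ((N : ℝ) ^ 2 * r) = N * Real.sqrt r := by
  rw [Real.sqrt_mul (sq_nonneg _), Real.sqrt_sq (Nat.cast_nonneg N)]

theorem exists_robinKernel_bound (hm : 1 ≤ m) (lam C Tf : ℝ) (hc : 0 < c) {κ : ℝ} (hκ : 0 < κ)
    (Am Ap : ℝ) : ∃ K : ℝ, 0 < K ∧
      ∀ (N : ℕ) (α : ℕ → ℝ), 2 * m ≤ N + 1 → JumpCoeffs N m lam c C α →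
      ∀ S T : ℝ, 0 ≤ S → S ≤ T → T ≤ Tf →
        (∀ x y : Fin (N + 1),
          robinKernel N m (modCoeff N m lam α) Am Ap S T x y * offDiagWeight N κ S T x y
            ≤ K * onDiagBound N S T) ∧
        (∀ x : Fin (N + 1), ∑ y : Fin (N + 1),
          robinKernel N m (modCoeff N m lam α) Am Ap S T x y * offDiagWeight N κ S T x y ≤ K) := by
  rcases le_or_gt C 0 with hC | hC
  · refine ⟨1, one_pos, fun N α hN h => ?_⟩
    exfalso
    have h1 : ((1 : ℕ) : ℝ) ^ 2 * α 1 ≤ ∑ k ∈ Finset.Icc 1 m, (k : ℝ) ^ 2 * α k :=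
      Finset.single_le_sum (f := fun k : ℕ => (k : ℝ) ^ 2 * α k)
        (fun k hk => mul_nonneg (sq_nonneg _) (h.pos k hk).le) (Finset.mem_Icc.2 ⟨le_rfl, hm⟩)
    simp only [Nat.cast_one, one_pow, one_mul] at h1
    linarith [h.moment, h.elliptic]
  set τ := max Tf 1 with hτ
  have hτ1 : 1 ≤ τ := le_max_right _ _
  -- The modified rates have ellipticity constant c/2, so the diagonal of the Fejér matrix is at
  -- least c/4 and β c/4 = |A₋| + |A₊|.
  set β := 4 / c * (|Am| + |Ap|) with hβ
  have hβ0 : 0 ≤ β := by positivity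
  -- Beyond `n₀` the modified rates are elliptic.
  obtain ⟨n₀, hn₀⟩ := exists_nat_ge (2 * lam ^ 2 * C / c)
  obtain ⟨K₁, hK₁, hbig⟩ := exists_exp_generator_bound (m := m) (c := c / 2)
    (C := (1 + lam ^ 2 * m) * C) hm (by linarith) (by positivity) hβ0 hτ1 hκ
  set K₂ := Real.exp (n₀ * (|Am| + |Ap|) * τ) * Real.exp (κ * n₀) with hK₂
  have hK₂0 : 0 < K₂ := by positivity
  refine ⟨K₁ + K₂ * (n₀ + 1), by positivity, fun N α hN h S T hS hST hT => ?_⟩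
  have hN1 : 1 ≤ N := by omega
  have hN0 : (0 : ℝ) < N := by exact_mod_cast hN1
  have hTS : T - S ≤ τ := by linarith [le_max_left Tf 1]
  have hTS0 : 0 ≤ T - S := by linarith
  have hb := inv_le_onDiagBound hN1 S T
  have hb0 : 0 ≤ onDiagBound N S T := le_trans (by positivity) hb
  have hE0 : ∀ x y, 0 ≤ offDiagWeight N κ S T x y := fun x y => (Real.exp_pos _).le
  have hU0 : ∀ x y, 0 ≤ robinKernel N m (modCoeff N m lam α) Am Ap S T x y :=
    fun x y => robinKernel_nonneg hm hN h.mod_nonneg Am Ap hST x y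
  have hsingle : ∀ x y : Fin (N + 1),
      robinKernel N m (modCoeff N m lam α) Am Ap S T x y * offDiagWeight N κ S T x y
        ≤ ∑ y, robinKernel N m (modCoeff N m lam α) Am Ap S T x y * offDiagWeight N κ S T x y :=
    fun x y => Finset.single_le_sum (f := fun y =>
      robinKernel N m (modCoeff N m lam α) Am Ap S T x y * offDiagWeight N κ S T x y)
      (fun z _ => mul_nonneg (hU0 x z) (hE0 x z)) (Finset.mem_univ y)
  -- For N ≤ n₀ kernel and weight are bounded outright, and the on-diagonal bound is at least 1/N ≥
  -- 1/n₀.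
  rcases le_or_gt N n₀ with hsmall | hlarge
  · have hNn : (N : ℝ) ≤ n₀ := by exact_mod_cast hsmall
    have hrow : ∀ x : Fin (N + 1), ∑ y : Fin (N + 1),
        robinKernel N m (modCoeff N m lam α) Am Ap S T x y * offDiagWeight N κ S T x y ≤ K₂ := by
      intro x
      calc _ ≤ ∑ y, robinKernel N m (modCoeff N m lam α) Am Ap S T x y * Real.exp (κ * n₀) := by
            refine Finset.sum_le_sum fun y _ => mul_le_mul_of_nonneg_left ?_ (hU0 x y)
            refine (offDiagWeight_le hκ.le S T x y).trans (Real.exp_le_exp.2 ?_)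
            gcongr
        _ ≤ _ := by
            rw [← Finset.sum_mul]
            refine mul_le_mul_of_nonneg_right ?_ (Real.exp_pos _).le
            refine (sum_robinKernel_le hm hN h.mod_nonneg Am Ap hST x).trans
              (Real.exp_le_exp.2 ?_)
            gcongr
    refine ⟨fun x y => ?_, fun x => ?_⟩
    · have h1 : 1 ≤ (n₀ + 1) * onDiagBound N S T := by
        have h2 : (N : ℝ) * (N : ℝ)⁻¹ = 1 := mul_inv_cancel₀ hN0.ne'
        have h3 := mul_le_mul_of_nonneg_left hb hN0.le
        nlinarith
      have h4 := (hsingle x y).trans (hrow x)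
      have h5 : K₂ * 1 ≤ K₂ * ((n₀ + 1) * onDiagBound N S T) :=
        mul_le_mul_of_nonneg_left h1 hK₂0.le
      have h6 : 0 ≤ K₁ * onDiagBound N S T := by positivity
      linarith
    · have h7 : (0 : ℝ) ≤ K₂ * n₀ := by positivity
      linarith [hrow x]
  · have hNn : (n₀ : ℝ) ≤ N := by exact_mod_cast hlarge.le
    have hrates := h.ellipticRates hm hN1 (by
      rw [div_le_iff₀ hc] at hn₀; nlinarith)
    set s := (N : ℝ) ^ 2 * (T - S) with hs
    have hs0 : 0 ≤ s := by positivity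
    have hsτ : s ≤ (N : ℝ) ^ 2 * τ := mul_le_mul_of_nonneg_left hTS (sq_nonneg _)
    obtain ⟨hrow, hpt⟩ := hbig N (modCoeff N m lam α) hN1 hrates s hs0 hsτ
    have hsqrt : Real.sqrt s = N * Real.sqrt |T - S| := by
      rw [hs, sqrt_sq_mul_eq, abs_of_nonneg hTS0]
    have hdom : ∀ x y, robinKernel N m (modCoeff N m lam α) Am Ap S T x y
        ≤ NormedSpace.exp (s • (fejerMatrix N m (modCoeff N m lam α) * pathLap N (β / N))) x y := by
      intro x y
      have hβc : β * (c / 2 / 2) = |Am| + |Ap| := by rw [hβ]; field_simp; ring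
      rw [robinKernel_eq hm hN]
      refine (Matrix.exp_apply_nonneg_le (fun u v huv => ?_) (fun u v => ?_) x y).2
      · exact mul_nonneg hTS0 (hrates.robinMatrix_offDiag_nonneg Am Ap huv)
      · have h1 := hrates.robinMatrix_le (Am := Am) (Ap := Ap) hm hN1 hβ0
          (by rw [hβc]; linarith [abs_nonneg Ap]) (by rw [hβc]; linarith [abs_nonneg Am]) u v
        have h2 := mul_le_mul_of_nonneg_left h1 hTS0
        simp only [Matrix.smul_apply, smul_eq_mul]
        rw [hs]
        linarith
    have hweight : ∀ x y : Fin (N + 1), offDiagWeight N κ S T x y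
        = Real.exp (κ * |((x : ℕ) : ℝ) - ((y : ℕ) : ℝ)| / max (Real.sqrt s) 1) := by
      intro x y; rw [hsqrt]; rfl
    have hrowU : ∀ x : Fin (N + 1), ∑ y : Fin (N + 1),
        robinKernel N m (modCoeff N m lam α) Am Ap S T x y * offDiagWeight N κ S T x y ≤ K₁ := by
      intro x
      refine le_trans (Finset.sum_le_sum fun y _ => ?_) (hrow x)
      rw [← hweight]
      exact mul_le_mul_of_nonneg_right (hdom x y) (hE0 x y)
    have hK₂' : 0 ≤ K₂ * (n₀ + 1) := by positivity
    refine ⟨fun x y => ?_, fun x => (hrowU x).trans (by linarith)⟩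
    have h1 := (hsingle x y).trans (hrowU x)
    have h2 : robinKernel N m (modCoeff N m lam α) Am Ap S T x y * offDiagWeight N κ S T x y
        ≤ K₁ * onDiagBound N S T := by
      unfold onDiagBound
      split_ifs with hSTeq
      · rw [mul_one]; exact h1
      · have hpos : 0 < T - S := by
          rcases hST.eq_or_lt with h' | h'
          · exact absurd h' hSTeq
          · linarith
        -- The cap 1 in the minimum comes from the row sum, since a single nonnegative term is at
        -- most the whole row.
        rw [mul_min_of_nonneg _ _ hK₁.le, mul_one]
        refine le_min ?_ h1
        have h3 := hpt (by positivity) x y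
        rw [← hweight] at h3
        refine (mul_le_mul_of_nonneg_right (hdom x y) (hE0 x y)).trans (h3.trans (le_of_eq ?_))
        rw [hsqrt, mul_inv, Real.rpow_neg (abs_nonneg _), ← Real.sqrt_eq_rpow]
    have h4 : 0 ≤ K₂ * (n₀ + 1) * onDiagBound N S T := by positivity
    linarith

end Robin

theorem mainTheorem4 (m : ℕ) (hm : 1 ≤ m) (lam c C Tf κ : ℝ) (hc : 0 < c) (hκ : 0 < κ) :
    (∃ K : ℝ, 0 < K ∧
      ∀ (N : ℕ) (α : ℕ → ℝ), 2 * m ≤ N + 1 → JumpCoeffs N m lam c C α →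
      ∀ S T : ℝ, 0 ≤ S → S ≤ T → T ≤ Tf →
        ∀ x y : Fin (N + 1),
          0 ≤ neumannKernel N m (modCoeff N m lam α) S T x y * offDiagWeight N κ S T x y ∧
          neumannKernel N m (modCoeff N m lam α) S T x y * offDiagWeight N κ S T x y
            ≤ K * onDiagBound N S T) ∧
    (∀ Am Ap : ℝ, ∃ K : ℝ, 0 < K ∧
      ∀ (N : ℕ) (α : ℕ → ℝ), 2 * m ≤ N + 1 → JumpCoeffs N m lam c C α →
      ∀ S T : ℝ, 0 ≤ S → S ≤ T → T ≤ Tf →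
        (∀ x y : Fin (N + 1),
          |robinKernel N m (modCoeff N m lam α) Am Ap S T x y * offDiagWeight N κ S T x y|
            ≤ K * onDiagBound N S T) ∧
        (∀ x : Fin (N + 1),
          ∑ y : Fin (N + 1),
            |robinKernel N m (modCoeff N m lam α) Am Ap S T x y * offDiagWeight N κ S T x y|
            ≤ K)) := by
  have hnn : ∀ (Am Ap : ℝ) (N : ℕ) (α : ℕ → ℝ), 2 * m ≤ N + 1 → JumpCoeffs N m lam c C α →
      ∀ S T : ℝ, S ≤ T → ∀ x y : Fin (N + 1),
        0 ≤ robinKernel N m (modCoeff N m lam α) Am Ap S T x y * offDiagWeight N κ S T x y :=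
    fun Am Ap N α hN h S T hST x y =>
      mul_nonneg (robinKernel_nonneg hm hN h.mod_nonneg Am Ap hST x y) (Real.exp_pos _).le
  refine ⟨?_, fun Am Ap => ?_⟩
  · obtain ⟨K, hK, hb⟩ := exists_robinKernel_bound hm lam C Tf hc hκ 0 0
    exact ⟨K, hK, fun N α hN h S T hS hST hT x y =>
      ⟨hnn 0 0 N α hN h S T hST x y, (hb N α hN h S T hS hST hT).1 x y⟩⟩
  · obtain ⟨K, hK, hb⟩ := exists_robinKernel_bound hm lam C Tf hc hκ Am Ap
    refine ⟨K, hK, fun N α hN h S T hS hST hT => ⟨fun x y => ?_, fun x => ?_⟩⟩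
    · rw [abs_of_nonneg (hnn Am Ap N α hN h S T hST x y)]
      exact (hb N α hN h S T hS hST hT).1 x y
    · rw [Finset.sum_congr rfl fun y _ => abs_of_nonneg (hnn Am Ap N α hN h S T hST x y)]
      exact (hb N α hN h S T hS hST hT).2 x

end
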